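/- **Proposition 1.** Let $\mathbb{T}_3=(\mathbb{R}/P\mathbb{Z})^3$ be the three-dimensional torus of period $P>0$, let $\nu>0$, $\alpha>0$, $T>0$, and let $m\ge 1$ be an integer. Let $f\in H^{m-1}(\mathbb{T}_3)^3$ (independent of time) and $u^{in}\in H^m(\mathbb{T}_3)^3$. Consider the modified Leray-$\alpha$ (ML-$\alpha$) system $$\partial_t u+(u\cdot\nabla)\overline u-\nu\Delta u+\nabla p=f,\qquad -\alpha^2\Delta\overline u+\overline u+\nabla\pi=u,$$ $$\nabla\cdot u=\nabla\cdot\overline u=0,\qquad \oint_{\mathbb{T}_3}u=\oint_{\mathbb{T}_3}\overline u=0,\qquad u|_{t=0}=u^{in},$$ on $[0,T)\times\mathbb{T}_3$, with the pressure normalized by $\oint_{\mathbb{T}_3}p=0$. Let $(u,\overline u,p,\pi)$ be a distributional solution of it with $u,\overline u\in L^2((0,T)\times\mathbb{T}_3)^3$, $p\in L^1((0,T)\times\mathbb{T}_3)$, and $p(t)\in L^2(\mathbb{T}_3)$, $\pi(t)\in L^1(\mathbb{T}_3)$ for almost every $t$. Here the second equation and the divergence and mean conditions hold for almost every $t$,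 and the first equation, with $(u\cdot\nabla)\overline u=\sum_j\partial_j(u_j\overline u)$, is tested together with the initial condition against all smooth functions with compact support in $[0,T)\times\mathbb{T}_3$. Then $$u\in L^\infty([0,T],H^m(\mathbb{T}_3)^3)\cap L^2([0,T],H^{m+1}(\mathbb{T}_3)^3),\qquad p\in L^2([0,T],H^m(\mathbb{T}_3)).$$ -/

import Mathlib

open MeasureTheory

noncomputable section

/-- The three-dimensional torus `(ℝ / P ℤ)³`. For `0 < P` its `volume` is Lebesgue measure, of total
mass `P ^ 3`. -/
abbrev Torus3 (P : ℝ) : Type := Fin 3 → AddCircle P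

namespace Torus3

variable {P : ℝ}

/-- The point of the torus represented by a point of `ℝ³`. -/
def mk (P : ℝ) (y : Fin 3 → ℝ) : Torus3 P := fun j => (y j : AddCircle P)

/-- The partial derivative `∂_j ψ` of a function on the torus. -/
def pderiv (j : Fin 3) (ψ : Torus3 P → ℝ) (x : Torus3 P) : ℝ :=
  deriv (fun s : ℝ => ψ (x + mk P (Pi.single j s))) 0

/-- The Laplacian `Δψ = ∑_j ∂_j ∂_j ψ`. -/
def laplacian (ψ : Torus3 P → ℝ) (x : Torus3 P) : ℝ :=
  ∑ j : Fin 3, pderiv j (pderiv j ψ) x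

/-- `ψ` is a `C^∞` function on the torus: its periodic lift to `ℝ³` is `C^∞`. -/
def IsSmooth (ψ : Torus3 P → ℝ) : Prop :=
  ContDiff ℝ ((⊤ : ℕ∞) : WithTop ℕ∞) (fun y : Fin 3 → ℝ => ψ (mk P y))

/-- `φ` is a `C^∞` test function with compact support in `[0, T) × 𝕋³` (it need not vanish at
time `0`). -/
def IsTestFunction (T : ℝ) (φ : ℝ → Torus3 P → ℝ) : Prop :=
  ContDiff ℝ ((⊤ : ℕ∞) : WithTop ℕ∞) (fun z : ℝ × (Fin 3 → ℝ) => φ z.1 (mk P z.2)) ∧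
    ∃ S < T, ∀ t, S ≤ t → ∀ x, φ t x = 0

variable [Fact (0 < P)]

/-- The Fourier coefficient `ĝ(k) = P⁻³ ∫ g(x) exp(-2πi k·x / P) dx`, `k ∈ ℤ³`. -/
def fourierCoeff (g : Torus3 P → ℝ) (k : Fin 3 → ℤ) : ℂ :=
  ((P : ℂ) ^ 3)⁻¹ * ∫ x : Torus3 P, (∏ j : Fin 3, fourier (-(k j)) (x j)) * (g x : ℂ)

/-- The squared length `|2πk / P|²` of the wave vector with index `k ∈ ℤ³`. -/
def waveSq (P : ℝ) (k : Fin 3 → ℤ) : ℝ := ∑ j : Fin 3, (2 * Real.pi * (k j : ℝ) / P) ^ 2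

/-- The Sobolev norm `‖g‖_{H^s} = (∑_k (1 + |2πk/P|²)^s |ĝ(k)|²)^{1/2}`, with values in
`[0, ∞]`. -/
def sobolevNorm (s : ℕ) (g : Torus3 P → ℝ) : ENNReal :=
  (∑' k : Fin 3 → ℤ, ENNReal.ofReal ((1 + waveSq P k) ^ s) * ‖fourierCoeff g k‖ₑ ^ 2) ^ (1 / 2 : ℝ)

/-- `g ∈ H^s(𝕋³)`, for an integer `s ≥ 0`. -/
def MemSobolev (s : ℕ) (g : Torus3 P → ℝ) : Prop :=
  MemLp g 2 volume ∧ sobolevNorm s g < ⊤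

/-- `v ∈ L^q(0, T; H^s(𝕋³))`. -/
def MemLpSobolev (q : ENNReal) (s : ℕ) (T : ℝ) (v : ℝ → Torus3 P → ℝ) : Prop :=
  AEStronglyMeasurable (Function.uncurry v) ((volume.restrict (Set.Ioo 0 T)).prod volume) ∧
  (∀ᵐ t ∂(volume.restrict (Set.Ioo 0 T)), MemSobolev s (v t)) ∧
  eLpNorm (fun t => sobolevNorm s (v t)) q (volume.restrict (Set.Ioo 0 T)) < ⊤

/-- `(u, ubar, p, π)` is a distributional solution on `[0, T) × 𝕋³` of the modified Leray-alpha
system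
`∂ₜu + (u·∇)ubar - νΔu + ∇p = f`, `-α²Δubar + ubar + ∇π = u`, `div u = div ubar = 0`,
`∮u = ∮ubar = 0`, `u(0) = uin`, with the pressure normalized by `∮p = 0`.
Vector fields are given by their three components. -/
structure IsMLAlphaSolution (ν α T : ℝ) (f uin : Fin 3 → Torus3 P → ℝ)
    (u ubar : Fin 3 → ℝ → Torus3 P → ℝ) (p π : ℝ → Torus3 P → ℝ) : Prop where
  /-- `u ∈ L²((0, T) × 𝕋³)³` -/
  memLp_u : ∀ i, MemLp (Function.uncurry (u i)) 2
    ((volume.restrict (Set.Ioo 0 T)).prod volume)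
  /-- `ubar ∈ L²((0, T) × 𝕋³)³` -/
  memLp_ubar : ∀ i, MemLp (Function.uncurry (ubar i)) 2
    ((volume.restrict (Set.Ioo 0 T)).prod volume)
  /-- `p ∈ L¹((0, T) × 𝕋³)` -/
  integrable_p : Integrable (Function.uncurry p)
    ((volume.restrict (Set.Ioo 0 T)).prod volume)
  /-- `p(t) ∈ L²(𝕋³)` for almost every `t` -/
  memLp_p : ∀ᵐ t ∂(volume.restrict (Set.Ioo 0 T)), MemLp (p t) 2 volume
  /-- `π(t) ∈ L¹(𝕋³)` for almost every `t` -/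
  integrable_π : ∀ᵐ t ∂(volume.restrict (Set.Ioo 0 T)), Integrable (π t) volume
  /-- The momentum equation with its initial condition, in the sense of distributions. Since
  `div u = 0`, the `i`-th component of `(u·∇)ubar` is `∑_j ∂_j (u_j ubar_i)`. -/
  momentum : ∀ i : Fin 3, ∀ φ : ℝ → Torus3 P → ℝ, IsTestFunction T φ →
    (∫ t in Set.Ioo 0 T, ∫ x,
      (-(u i t x * deriv (fun s => φ s x) t)
        - (∑ j : Fin 3, u j t x * ubar i t x * pderiv j (φ t) x)
        - ν * (u i t x * laplacian (φ t) x)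
        - p t x * pderiv i (φ t) x))
      = (∫ t in Set.Ioo 0 T, ∫ x, f i x * φ t x) + ∫ x, uin i x * φ 0 x
  /-- `-α²Δubar + ubar + ∇π = u` on `𝕋³`, in the sense of distributions. -/
  filter : ∀ᵐ t ∂(volume.restrict (Set.Ioo 0 T)), ∀ i : Fin 3, ∀ ψ : Torus3 P → ℝ, IsSmooth ψ →
    (∫ x, (-(α ^ 2 * (ubar i t x * laplacian ψ x)) + ubar i t x * ψ x - π t x * pderiv i ψ x))
      = ∫ x, u i t x * ψ x
  /-- `div u = 0` -/
  div_u : ∀ᵐ t ∂(volume.restrict (Set.Ioo 0 T)), ∀ ψ : Torus3 P → ℝ, IsSmooth ψ →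
    (∫ x, ∑ j : Fin 3, u j t x * pderiv j ψ x) = 0
  /-- `div ubar = 0` -/
  div_ubar : ∀ᵐ t ∂(volume.restrict (Set.Ioo 0 T)), ∀ ψ : Torus3 P → ℝ, IsSmooth ψ →
    (∫ x, ∑ j : Fin 3, ubar j t x * pderiv j ψ x) = 0
  mean_u : ∀ᵐ t ∂(volume.restrict (Set.Ioo 0 T)), ∀ i : Fin 3, (∫ x, u i t x) = 0
  mean_ubar : ∀ᵐ t ∂(volume.restrict (Set.Ioo 0 T)), ∀ i : Fin 3, (∫ x, ubar i t x) = 0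
  mean_p : ∀ᵐ t ∂(volume.restrict (Set.Ioo 0 T)), (∫ x, p t x) = 0

end Torus3

end

/-!
The argument takes place on the Fourier side. Let `R k t` be the sum over `i` of the moduli of the
coefficients of `u i t` at the frequency `k`, and `J k = 1 + |2πk/P|²`. Tested against
trigonometric functions, the filter equation together with `div u = div ubar = 0` gives
`(1 + α² |2πk/P|²) ubar^(k) = u^(k)`: the filtered field has two derivatives more than `u`, and
the coefficients of `u ⊗ ubar` are dominated by the convolution `G` of `R` with `R / J`
(`smoothedConv`). The divergence of the momentum equation expresses the pressure through `G` and
the force `f`, and the momentum equation itself becomes a linear ordinary differential equation in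
the sense of distributions for every `k`, hence a Duhamel formula (`ae_eq_duhamel`). Together,
`R k t ≤ e^{-c t} r k + κ ∫₀ᵗ e^{-c (t - s)} A (G k s + H k) ds`, with `c = ν |2πk/P|²`,
`κ = |2πk/P|`, where `r` and `H` are sums of moduli of the coefficients of `uin` and of those of
`f` divided by `κ`; this is `IsSolutionMajorant`. From here on only this inequality between
nonnegative functions is used.

In dimension three `∑ J⁻²` is finite, so that `∑ J^s G² ≤ C (∑ R²) (∑ J^s R²)`
(`tsum_pow_mul_smoothedConv_sq_le`). A solution is only known to be square integrable in time, and
the forcing `G` therefore only integrable in time with values in `L²`; the Duhamel inequality then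
gives a bound in `L^∞(0, T; H⁻¹)`. The product estimate holds also for the weights `(1 + ε J)⁻¹` in
place of `J^s`, uniformly in `ε` (`tsum_inv_mul_smoothedConv_sq_le`). The corresponding norms are
finite by the `H⁻¹` bound, and Gronwall's inequality, whose integrable coefficient is a multiple of
`∑ R²`, bounds them by a constant independent of `ε`. As `ε → 0`, this is a bound in
`L^∞(0, T; L²)` (`exists_ae_tsum_sq_le`).

Now the product estimate makes the forcing as regular as the solution, and the smoothing of the heat
flow, `κ² ∫ e^{-c s} ds ≤ ν⁻¹`, turns a forcing in `L²(0, T; H^s)` into a solution in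
`L^∞(0, T; H^s) ∩ L²(0, T; H^{s+1})`, as long as `s ≤ m` (`gain_derivative`). The induction on `s`
ends with the claim for `u`; since `p` is dominated by `G` and `H`, the claim for `p` follows.
-/

/-! ### Inequalities in `[0, ∞]` -/

namespace MLAlpha

open Set
open scoped ENNReal NNReal

theorem add_pow_le_two_pow_mul (a b : ℝ≥0∞) (n : ℕ) : (a + b) ^ n ≤ 2 ^ n * (a ^ n + b ^ n) := by
  wlog hab : a ≤ b generalizing a b
  · rw [add_comm a b, add_comm (a ^ n)]
    exact this b a (le_of_not_ge hab)
  calc (a + b) ^ n ≤ (2 * b) ^ n := by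
        gcongr
        rw [two_mul]
        gcongr
    _ = 2 ^ n * b ^ n := mul_pow _ _ _
    _ ≤ 2 ^ n * (a ^ n + b ^ n) := by
        gcongr
        exact le_add_self

theorem sq_add_le (a b : ℝ≥0∞) : (a + b) ^ 2 ≤ 4 * (a ^ 2 + b ^ 2) := by
  refine (add_pow_le_two_pow_mul a b 2).trans_eq ?_
  norm_num

/-- The Cauchy–Schwarz inequality. -/
theorem sq_lintegral_mul_le {X : Type*} [MeasurableSpace X] {μ : Measure X} {f g : X → ℝ≥0∞}
    (hf : AEMeasurable f μ) (hg : AEMeasurable g μ) :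
    (∫⁻ x, f x * g x ∂μ) ^ 2 ≤ (∫⁻ x, f x ^ 2 ∂μ) * ∫⁻ x, g x ^ 2 ∂μ := by
  have h := ENNReal.lintegral_mul_le_Lp_mul_Lq μ Real.HolderConjugate.two_two hf hg
  have h2 : ∀ a : ℝ≥0∞, (a ^ (1 / 2 : ℝ)) ^ 2 = a := fun a => by
    rw [← ENNReal.rpow_natCast, ← ENNReal.rpow_mul]
    norm_num
  calc (∫⁻ x, f x * g x ∂μ) ^ 2
      ≤ ((∫⁻ x, f x ^ (2 : ℝ) ∂μ) ^ (1 / 2 : ℝ) * (∫⁻ x, g x ^ (2 : ℝ) ∂μ) ^ (1 / 2 : ℝ)) ^ 2 := by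
        gcongr
        exact h
    _ = _ := by
        rw [mul_pow, h2, h2]
        simp only [ENNReal.rpow_two]

theorem sq_lintegral_le_weight {X : Type*} [MeasurableSpace X] {μ : Measure X}
    {w f : X → ℝ≥0∞} (hw : AEMeasurable w μ) (hf : AEMeasurable f μ) :
    (∫⁻ x, w x * f x ∂μ) ^ 2 ≤ (∫⁻ x, w x ∂μ) * ∫⁻ x, w x * f x ^ 2 ∂μ := by
  have h2 : ∀ a : ℝ≥0∞, (a ^ (1 / 2 : ℝ)) ^ 2 = a := fun a => by
    rw [← ENNReal.rpow_natCast, ← ENNReal.rpow_mul]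
    norm_num
  have hs : AEMeasurable (fun x => w x ^ (1 / 2 : ℝ)) μ := hw.pow_const _
  have h := sq_lintegral_mul_le hs (hs.mul hf)
  simp only [Pi.mul_apply, ← mul_assoc, ← sq, mul_pow, h2] at h
  exact h

theorem sq_tsum_mul_le {ι : Type*} (f g : ι → ℝ≥0∞) :
    (∑' i, f i * g i) ^ 2 ≤ (∑' i, f i ^ 2) * ∑' i, g i ^ 2 := by
  let _ : MeasurableSpace ι := ⊤
  have h := sq_lintegral_mul_le (μ := Measure.count) (f := f) (g := g)
    measurable_from_top.aemeasurable measurable_from_top.aemeasurable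
  simpa only [lintegral_count] using h

/-! ### Bilinear estimates for sequences indexed by frequencies -/

variable {ι : Type*} [AddCommGroup ι]

/-- The properties of `J k = 1 + |2πk/P|²` that the bilinear estimates need: bounds, a
quasi-triangle inequality, and summability of `J⁻²`, which holds in dimension three. -/
structure IsFrequencyWeight (J : ι → ℝ≥0∞) : Prop where
  one_le : ∀ k, 1 ≤ J k
  ne_top : ∀ k, J k ≠ ⊤
  neg : ∀ k, J (-k) = J k
  le_add : ∀ k l, J k ≤ 2 * (J l + J (k - l))
  tsum_ne_top : ∑' k, (J k)⁻¹ ^ 2 ≠ ⊤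

/-- The convolution `∑_l r(l) r(k-l) / J(k-l)`: it dominates the Fourier coefficients of `u ⊗ ubar`
when `r` dominates those of `u`. -/
noncomputable def smoothedConv (J r : ι → ℝ≥0∞) (k : ι) : ℝ≥0∞ :=
  ∑' l, r l * (r (k - l) * (J (k - l))⁻¹)

variable {J : ι → ℝ≥0∞}

theorem IsFrequencyWeight.ne_zero (hJ : IsFrequencyWeight J) (k : ι) : J k ≠ 0 :=
  (zero_lt_one.trans_le (hJ.one_le k)).ne'

theorem tsum_sub_left (k : ι) (f : ι → ℝ≥0∞) : ∑' l, f (k - l) = ∑' l, f l :=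
  (Equiv.subLeft k).tsum_eq f

theorem tsum_sub_right (l : ι) (f : ι → ℝ≥0∞) : ∑' k, f (k - l) = ∑' k, f k :=
  (Equiv.subRight l).tsum_eq f

/-- The tame product estimate in `H^s`: the two derivatives gained by the second factor pay for the
Cauchy–Schwarz inequality in the convolution. -/
theorem tsum_pow_mul_smoothedConv_sq_le (hJ : IsFrequencyWeight J) (s : ℕ) (r : ι → ℝ≥0∞) :
    ∑' k, J k ^ s * smoothedConv J r k ^ 2 ≤
      (2 * 4 ^ s * ∑' k, (J k)⁻¹ ^ 2) * ((∑' k, r k ^ 2) * ∑' k, J k ^ s * r k ^ 2) := by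
  set S := ∑' k, (J k)⁻¹ ^ 2
  have h1 : ∀ k, smoothedConv J r k ^ 2 ≤ S * ∑' l, r l ^ 2 * r (k - l) ^ 2 := fun k => by
    have h := sq_tsum_mul_le (fun l => (J (k - l))⁻¹) (fun l => r l * r (k - l))
    rw [tsum_sub_left k (fun l => (J l)⁻¹ ^ 2)] at h
    simp only [mul_pow] at h
    refine le_trans (le_of_eq ?_) h
    unfold smoothedConv
    congr 1
    exact tsum_congr fun l => by ring
  have h2 : ∀ k l, J k ^ s ≤ 4 ^ s * (J l ^ s + J (k - l) ^ s) := fun k l =>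
    calc J k ^ s ≤ (2 * (J l + J (k - l))) ^ s := by gcongr; exact hJ.le_add k l
      _ ≤ 2 ^ s * (2 ^ s * (J l ^ s + J (k - l) ^ s)) := by
        rw [mul_pow]; gcongr; exact add_pow_le_two_pow_mul _ _ _
      _ = _ := by rw [← mul_assoc, ← mul_pow]; norm_num
  calc ∑' k, J k ^ s * smoothedConv J r k ^ 2
      ≤ ∑' k, ∑' l, (S * 4 ^ s) *
          (J l ^ s * r l ^ 2 * r (k - l) ^ 2 + r l ^ 2 * (J (k - l) ^ s * r (k - l) ^ 2)) := by
        refine ENNReal.tsum_le_tsum fun k => ?_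
        calc J k ^ s * smoothedConv J r k ^ 2 ≤ J k ^ s * (S * ∑' l, r l ^ 2 * r (k - l) ^ 2) := by
              gcongr; exact h1 k
          _ = ∑' l, S * (J k ^ s * (r l ^ 2 * r (k - l) ^ 2)) := by
              rw [ENNReal.tsum_mul_left, ENNReal.tsum_mul_left]; ring
          _ ≤ _ := by
              refine ENNReal.tsum_le_tsum fun l => ?_
              calc S * (J k ^ s * (r l ^ 2 * r (k - l) ^ 2))
                  ≤ S * ((4 ^ s * (J l ^ s + J (k - l) ^ s)) * (r l ^ 2 * r (k - l) ^ 2)) := by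
                    gcongr; exact h2 k l
                _ = _ := by ring
    _ = _ := by
        rw [ENNReal.tsum_comm]
        simp only [ENNReal.tsum_mul_left, ENNReal.tsum_add]
        have e1 : ∀ l, ∑' k, r (k - l) ^ 2 = ∑' k, r k ^ 2 := fun l =>
          tsum_sub_right l (fun k => r k ^ 2)
        have e2 : ∀ l, ∑' k, J (k - l) ^ s * r (k - l) ^ 2 = ∑' k, J k ^ s * r k ^ 2 := fun l =>
          tsum_sub_right l (fun k => J k ^ s * r k ^ 2)
        simp only [e1, e2, ENNReal.tsum_mul_right]
        ring

/-- A Peetre-type inequality for the weight `(1 + ε J)⁻¹`, uniform in `ε`. -/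
theorem inv_one_add_mul_le (hJ : IsFrequencyWeight J) (ε : ℝ≥0) (k l : ι) :
    (1 + ε * J k)⁻¹ * (J (k - l))⁻¹ ^ 2 ≤
      (1 + ε * J l)⁻¹ * (4 * ((J (k - l))⁻¹ ^ 2 + (J k)⁻¹ ^ 2)) := by
  have hk := hJ.one_le k
  have hd := hJ.one_le (k - l)
  have hadd := hJ.le_add l k
  rw [← neg_sub k l, hJ.neg] at hadd
  generalize hj : J (k - l) = j at *
  lift J k to ℝ≥0 using hJ.ne_top k with a
  lift J l to ℝ≥0 using hJ.ne_top l with b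
  lift j to ℝ≥0 using hj ▸ hJ.ne_top (k - l)
  norm_cast at hk hd hadd
  have ha0 : a ≠ 0 := (zero_lt_one.trans_le hk).ne'
  have hj0 : j ≠ 0 := (zero_lt_one.trans_le hd).ne'
  have key : (1 + ε * a)⁻¹ * j⁻¹ ^ 2 ≤ (1 + ε * b)⁻¹ * (4 * (j⁻¹ ^ 2 + a⁻¹ ^ 2)) := by
    have e1 : (1 + ε * a)⁻¹ * j⁻¹ ^ 2 = 1 / ((1 + ε * a) * j ^ 2) := by field_simp
    have e2 : (1 + ε * b)⁻¹ * (4 * (j⁻¹ ^ 2 + a⁻¹ ^ 2)) =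
        (4 * (a ^ 2 + j ^ 2)) / ((1 + ε * b) * (j ^ 2 * a ^ 2)) := by field_simp
    rw [e1, e2, div_le_div_iff₀ (by positivity) (by positivity)]
    have main : (1 + ε * b) * a ^ 2 ≤ 4 * (a ^ 2 + j ^ 2) * (1 + ε * a) := by
      rw [← NNReal.coe_le_coe] at hadd hk hd ⊢
      push_cast at hadd hk hd ⊢
      have hε : (0 : ℝ) ≤ ε := ε.coe_nonneg
      have h1 : (ε : ℝ) * a ^ 2 * b ≤ ε * a ^ 2 * (2 * (a + j)) :=
        mul_le_mul_of_nonneg_left (by linarith) (by positivity)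
      have h2 : 0 ≤ (ε : ℝ) * a * (a - j) ^ 2 := by positivity
      have h3 : 0 ≤ (ε : ℝ) * a * j ^ 2 := by positivity
      have h4 : 0 ≤ (ε : ℝ) * a ^ 3 := by positivity
      nlinarith [sq_nonneg (a : ℝ), sq_nonneg (j : ℝ)]
    calc 1 * ((1 + ε * b) * (j ^ 2 * a ^ 2)) = ((1 + ε * b) * a ^ 2) * j ^ 2 := by ring
      _ ≤ (4 * (a ^ 2 + j ^ 2) * (1 + ε * a)) * j ^ 2 := by gcongr
      _ = _ := by ring
  have := ENNReal.coe_le_coe.2 key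
  have hp : ∀ c : ℝ≥0, 1 + ε * c ≠ 0 := fun c => by positivity
  simpa only [ENNReal.coe_mul, ENNReal.coe_pow, ENNReal.coe_inv (hp _), ENNReal.coe_inv ha0,
    ENNReal.coe_inv hj0, ENNReal.coe_add, ENNReal.coe_one, ENNReal.coe_ofNat] using this

/-- Multiplication by a function in `H²` is bounded on the Hilbert space with weight
`(1 + ε J)⁻¹`, uniformly in `ε`. -/
theorem tsum_inv_mul_smoothedConv_sq_le (hJ : IsFrequencyWeight J) (ε : ℝ≥0) (r : ι → ℝ≥0∞) :
    ∑' k, (1 + ε * J k)⁻¹ * smoothedConv J r k ^ 2 ≤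
      (8 * ∑' k, (J k)⁻¹ ^ 2) * ((∑' k, r k ^ 2) * ∑' k, (1 + ε * J k)⁻¹ * r k ^ 2) := by
  set S := ∑' k, (J k)⁻¹ ^ 2 with hS
  have h1 : ∀ k, smoothedConv J r k ^ 2 ≤
      (∑' l, r l ^ 2) * ∑' l, r l ^ 2 * (J (k - l))⁻¹ ^ 2 := fun k => by
    have h := sq_tsum_mul_le (fun l => r (k - l)) (fun l => r l * (J (k - l))⁻¹)
    rw [tsum_sub_left k (fun l => r l ^ 2)] at h
    simp only [mul_pow] at h
    refine le_trans (le_of_eq ?_) h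
    unfold smoothedConv
    congr 1
    exact tsum_congr fun l => by ring
  have h2 : ∀ l, ∑' k, ((J (k - l))⁻¹ ^ 2 + (J k)⁻¹ ^ 2) = 2 * S := fun l => by
    rw [ENNReal.tsum_add, tsum_sub_right l (fun k => (J k)⁻¹ ^ 2), two_mul]
  calc ∑' k, (1 + ε * J k)⁻¹ * smoothedConv J r k ^ 2
      ≤ ∑' k, ∑' l, (∑' l, r l ^ 2) * (r l ^ 2 * ((1 + ε * J k)⁻¹ * (J (k - l))⁻¹ ^ 2)) := by
        refine ENNReal.tsum_le_tsum fun k => ?_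
        calc (1 + ε * J k)⁻¹ * smoothedConv J r k ^ 2
            ≤ (1 + ε * J k)⁻¹ * ((∑' l, r l ^ 2) * ∑' l, r l ^ 2 * (J (k - l))⁻¹ ^ 2) := by
              gcongr; exact h1 k
          _ = _ := by
              rw [ENNReal.tsum_mul_left, mul_left_comm, ← ENNReal.tsum_mul_left]
              congr 1
              exact tsum_congr fun l => by ring
    _ ≤ ∑' k, ∑' l, (∑' l, r l ^ 2) *
          (r l ^ 2 * ((1 + ε * J l)⁻¹ * (4 * ((J (k - l))⁻¹ ^ 2 + (J k)⁻¹ ^ 2)))) := by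
        refine ENNReal.tsum_le_tsum fun k => ENNReal.tsum_le_tsum fun l => ?_
        exact mul_le_mul_right (mul_le_mul_right (inv_one_add_mul_le hJ ε k l) _) _
    _ = _ := by
        rw [ENNReal.tsum_comm]
        simp only [ENNReal.tsum_mul_left, h2]
        rw [mul_comm (8 * S), mul_assoc]
        congr 1
        rw [← ENNReal.tsum_mul_right]
        exact tsum_congr fun l => by ring

/-! ### Exponential kernels and Gronwall's inequality -/

/-- The causal heat kernel `e^{-λ s}` for `s > 0`, extended by zero. -/
noncomputable def decay (c s : ℝ) : ℝ≥0∞ :=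
  (Ioi (0 : ℝ)).indicator (fun s => ENNReal.ofReal (Real.exp (-c * s))) s

theorem measurable_decay (c : ℝ) : Measurable (decay c) :=
  Measurable.indicator (by fun_prop) measurableSet_Ioi

theorem decay_le_one {c : ℝ} (hc : 0 ≤ c) (s : ℝ) : decay c s ≤ 1 := by
  refine indicator_le' (g := fun _ => (1 : ℝ≥0∞)) (fun s hs => ?_) (fun _ _ => zero_le) s
  rw [ENNReal.ofReal_le_one, Real.exp_le_one_iff]
  exact mul_nonpos_of_nonpos_of_nonneg (neg_nonpos.2 hc) (le_of_lt hs)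

theorem decay_of_pos {s : ℝ} (hs : 0 < s) (c : ℝ) :
    decay c s = ENNReal.ofReal (Real.exp (-c * s)) := indicator_of_mem hs _

theorem decay_of_nonpos {s : ℝ} (hs : s ≤ 0) (c : ℝ) : decay c s = 0 :=
  indicator_of_notMem (by simpa using hs) _

theorem lintegral_decay {c : ℝ} (hc : 0 < c) : ∫⁻ s, decay c s = ENNReal.ofReal c⁻¹ := by
  unfold decay
  rw [lintegral_indicator measurableSet_Ioi,
    ← ofReal_integral_eq_lintegral_ofReal (integrableOn_exp_mul_Ioi (by linarith) 0)
      (Filter.Eventually.of_forall fun _ => (Real.exp_pos _).le),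
    integral_exp_mul_Ioi (by linarith)]
  simp [neg_div_neg_eq]

theorem lintegral_decay_sub_le {c : ℝ} (hc : 0 < c) (μ : Measure ℝ) (hμ : μ ≤ volume) (t : ℝ) :
    ∫⁻ s, decay c (t - s) ∂μ ≤ ENNReal.ofReal c⁻¹ := by
  rw [← lintegral_decay hc, ← lintegral_sub_left_eq_self (decay c) t]
  exact lintegral_mono' hμ le_rfl

/-- A sufficiently fast decay makes the convolution with an integrable function small: where `B` is
large its integral is small, and elsewhere the integral of the kernel is. -/
theorem exists_lintegral_decay_mul_le {μ : Measure ℝ} (hμ : μ ≤ volume) {B : ℝ → ℝ≥0∞}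
    (hB : AEMeasurable B μ) (hBi : ∫⁻ s, B s ∂μ ≠ ⊤) :
    ∃ c : ℝ, 0 < c ∧ ∀ t, ∫⁻ s, decay c (t - s) * B s ∂μ ≤ 2⁻¹ := by
  obtain ⟨δ, hδ, hδB⟩ := exists_pos_setLIntegral_lt_of_measure_lt hBi
    (ε := 4⁻¹) (by norm_num)
  obtain ⟨N, hN⟩ : ∃ N : ℝ≥0, 0 < N ∧ μ {s | (N : ℝ≥0∞) ≤ B s} < δ := by
    obtain ⟨n, hn⟩ := ENNReal.exists_nat_mul_gt hδ.ne' hBi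
    have hn0 : (n : ℝ≥0∞) ≠ 0 := by rintro h; simp [h] at hn
    refine ⟨n, by exact_mod_cast pos_iff_ne_zero.2 hn0, ?_⟩
    have h := mul_meas_ge_le_lintegral₀ hB n
    have h' := h.trans_lt hn
    exact (ENNReal.mul_lt_mul_iff_right hn0 (by simp)).1 (by simpa using h')
  refine ⟨4 * N, by have := hN.1; positivity, fun t => ?_⟩
  have hc : (0 : ℝ) < 4 * N := by have := hN.1; positivity
  set U := {s | (N : ℝ≥0∞) ≤ B s}
  have hU : NullMeasurableSet U μ := nullMeasurableSet_le aemeasurable_const hB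
  have h1 : ∀ s, decay (4 * N) (t - s) * B s ≤ U.indicator B s + N * decay (4 * N) (t - s) := by
    intro s
    by_cases hs : s ∈ U
    · rw [indicator_of_mem hs]
      exact le_add_right (mul_le_of_le_one_left zero_le (decay_le_one hc.le _))
    · rw [indicator_of_notMem hs, zero_add, mul_comm]
      gcongr
      exact (not_le.1 hs).le
  calc ∫⁻ s, decay (4 * N) (t - s) * B s ∂μ
      ≤ ∫⁻ s, (U.indicator B s + N * decay (4 * N) (t - s)) ∂μ := lintegral_mono h1
    _ = ∫⁻ s in U, B s ∂μ + N * ∫⁻ s, decay (4 * N) (t - s) ∂μ := by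
        have hm : Measurable fun s => decay (4 * N) (t - s) :=
          (measurable_decay _).comp (measurable_const.sub measurable_id)
        rw [lintegral_add_right _ (hm.const_mul _), lintegral_indicator₀ hU,
          lintegral_const_mul _ hm]
    _ ≤ 4⁻¹ + N * ENNReal.ofReal (4 * N)⁻¹ := by
        gcongr
        · exact (hδB U hN.2).le
        · exact lintegral_decay_sub_le hc μ hμ t
    _ = 2⁻¹ := by
        have hN0 : (N : ℝ) ≠ 0 := by exact_mod_cast hN.1.ne'
        have e : (N : ℝ≥0∞) = ENNReal.ofReal N := by simp
        rw [e, ← ENNReal.ofReal_mul (by positivity)]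
        have e4 : (4 : ℝ≥0∞)⁻¹ = ENNReal.ofReal 4⁻¹ := by
          rw [ENNReal.ofReal_inv_of_pos (by norm_num)]; norm_num
        have e2 : (2 : ℝ≥0∞)⁻¹ = ENNReal.ofReal 2⁻¹ := by
          rw [ENNReal.ofReal_inv_of_pos (by norm_num)]; norm_num
        rw [e4, e2, ← ENNReal.ofReal_add (by norm_num) (by positivity)]
        congr 1
        field_simp
        norm_num

/-- **Gronwall's inequality** with an integrable coefficient `B`, for functions known to be
bounded; the constant depends on `B` alone. -/
theorem exists_gronwall {T : ℝ} {B : ℝ → ℝ≥0∞}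
    (hB : AEMeasurable B (volume.restrict (Ioo 0 T)))
    (hBi : ∫⁻ s in Ioo 0 T, B s ≠ ⊤) :
    ∃ D : ℝ≥0∞, D ≠ ⊤ ∧ ∀ (X : ℝ → ℝ≥0∞) (A M : ℝ≥0∞), M ≠ ⊤ →
      (∀ᵐ t ∂volume.restrict (Ioo 0 T), X t ≤ M) →
      (∀ᵐ t ∂volume.restrict (Ioo 0 T),
        X t ≤ A + ∫⁻ s in Ioo 0 T, (Iio t).indicator (fun s => B s * X s) s) →
      ∀ᵐ t ∂volume.restrict (Ioo 0 T), X t ≤ D * A := by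
  set μ := volume.restrict (Ioo 0 T)
  -- with respect to the weight `e^{-ct}` the integral operator has norm at most `1/2`
  obtain ⟨c, hc, hcB⟩ := exists_lintegral_decay_mul_le (μ := μ) Measure.restrict_le_self hB hBi
  let e : ℝ → ℝ≥0∞ := fun t => ENNReal.ofReal (Real.exp (c * t))
  refine ⟨e T * 2, ENNReal.mul_ne_top ENNReal.ofReal_ne_top (by simp), ?_⟩
  intro X A M hM hXM hX
  have he : ∀ t, e t ≠ 0 := fun t => by simp [e, Real.exp_pos]
  have he' : ∀ t, e t ≠ ⊤ := fun t => ENNReal.ofReal_ne_top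
  have he1 : ∀ t, 0 < t → 1 ≤ e t := fun t ht => by
    simp only [e, ENNReal.one_le_ofReal, Real.one_le_exp_iff]; positivity
  -- `Z` is the norm of `X` weighted by `e^{-ct}`
  set Z := essSup (fun t => (e t)⁻¹ * X t) μ with hZ
  have hpos : ∀ᵐ t ∂μ, t ∈ Ioo 0 T := ae_restrict_mem measurableSet_Ioo
  have hZX : ∀ᵐ t ∂μ, X t ≤ e t * Z := by
    filter_upwards [ENNReal.ae_le_essSup (μ := μ) (fun t => (e t)⁻¹ * X t)] with t ht
    rw [← hZ] at ht
    calc X t = e t * ((e t)⁻¹ * X t) := by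
          rw [← mul_assoc, ENNReal.mul_inv_cancel (he t) (he' t), one_mul]
      _ ≤ e t * Z := by gcongr
  have hZM : Z ≤ M := by
    refine essSup_le_of_ae_le _ ?_
    filter_upwards [hXM, hpos] with t ht h0
    exact (mul_le_of_le_one_left zero_le (ENNReal.inv_le_one.2 (he1 t h0.1))).trans ht
  have hZA : Z ≤ A + 2⁻¹ * Z := by
    refine essSup_le_of_ae_le _ ?_
    filter_upwards [hX, hpos] with t ht h0
    have h1 : ∫⁻ s, (Iio t).indicator (fun s => B s * X s) s ∂μ ≤ e t * (2⁻¹ * Z) := by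
      calc ∫⁻ s, (Iio t).indicator (fun s => B s * X s) s ∂μ
          ≤ ∫⁻ s, e t * Z * (decay c (t - s) * B s) ∂μ := by
            refine lintegral_mono_ae ?_
            filter_upwards [hZX] with s hs
            by_cases hst : s < t
            · rw [indicator_of_mem (by exact hst), decay_of_pos (sub_pos.2 hst)]
              have hes : e s = e t * ENNReal.ofReal (Real.exp (-c * (t - s))) := by
                simp only [e]
                rw [← ENNReal.ofReal_mul (Real.exp_pos _).le, ← Real.exp_add]
                ring_nf
              calc B s * X s ≤ B s * (e s * Z) := by gcongr
                _ = _ := by rw [hes]; ring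
            · rw [indicator_of_notMem (by simpa using hst)]
              exact zero_le
        _ = e t * Z * ∫⁻ s, decay c (t - s) * B s ∂μ := by
            rw [lintegral_const_mul' _ _
              (ENNReal.mul_ne_top (he' t) (ne_top_of_le_ne_top hM hZM))]
        _ ≤ e t * Z * 2⁻¹ := by gcongr; exact hcB t
        _ = _ := by ring
    calc (e t)⁻¹ * X t ≤ (e t)⁻¹ * (e t * A + e t * (2⁻¹ * Z)) := by
          gcongr
          refine ht.trans (add_le_add ?_ h1)
          exact le_mul_of_one_le_left zero_le (he1 t h0.1)
      _ = A + 2⁻¹ * Z := by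
          rw [← mul_add, ← mul_assoc, ENNReal.inv_mul_cancel (he t) (he' t), one_mul]
  have hZ2 : Z ≤ 2 * A := by
    have hZt : 2⁻¹ * Z ≠ ⊤ := ENNReal.mul_ne_top (by simp) (ne_top_of_le_ne_top hM hZM)
    have h3 : 2⁻¹ * Z + 2⁻¹ * Z ≤ A + 2⁻¹ * Z := by
      rw [← add_mul, ENNReal.inv_two_add_inv_two, one_mul]; exact hZA
    have h4 : 2⁻¹ * Z ≤ A := (ENNReal.add_le_add_iff_right hZt).1 h3
    calc Z = 2 * (2⁻¹ * Z) := by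
          rw [← mul_assoc, ENNReal.mul_inv_cancel (by simp) (by simp), one_mul]
      _ ≤ 2 * A := by gcongr
  filter_upwards [hZX, hpos] with t ht h0
  calc X t ≤ e t * Z := ht
    _ ≤ e T * (2 * A) := by
        gcongr
        exact ENNReal.ofReal_le_ofReal (Real.exp_le_exp.2 (by nlinarith [h0.2]))
    _ = _ := by ring

end MLAlpha

namespace MLAlpha

open Set
open scoped ENNReal NNReal

/-! ### Parabolic regularity for nonnegative majorants -/

section Parabolic

variable {ι : Type*} {T : ℝ}

theorem aemeasurable_decay_mul {μ : Measure ℝ} (c t : ℝ) {h : ℝ → ℝ≥0∞} (hh : AEMeasurable h μ) :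
    AEMeasurable (fun s => decay c (t - s) * h s) μ :=
  (((measurable_decay c).comp (measurable_const.sub measurable_id)).aemeasurable).mul hh

theorem sq_mul_lintegral_decay_le {μ : Measure ℝ} (hμ : μ ≤ volume) {κ C : ℝ≥0∞} {c : ℝ}
    (hκ : κ ^ 2 * ∫⁻ s, decay c s ≤ C) (t : ℝ) {h : ℝ → ℝ≥0∞} (hh : AEMeasurable h μ) :
    (κ * ∫⁻ s, decay c (t - s) * h s ∂μ) ^ 2 ≤ C * ∫⁻ s, decay c (t - s) * h s ^ 2 ∂μ := by
  have hd : AEMeasurable (fun s => decay c (t - s)) μ :=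
    ((measurable_decay c).comp (measurable_const.sub measurable_id)).aemeasurable
  calc (κ * ∫⁻ s, decay c (t - s) * h s ∂μ) ^ 2
      ≤ κ ^ 2 * ((∫⁻ s, decay c (t - s) ∂μ) * ∫⁻ s, decay c (t - s) * h s ^ 2 ∂μ) := by
        rw [mul_pow]
        gcongr
        exact sq_lintegral_le_weight hd hh
    _ ≤ κ ^ 2 * ((∫⁻ s, decay c s) * ∫⁻ s, decay c (t - s) * h s ^ 2 ∂μ) := by
        have hle : ∫⁻ s, decay c (t - s) ∂μ ≤ ∫⁻ s, decay c s :=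
          (lintegral_mono' hμ le_rfl).trans_eq (lintegral_sub_left_eq_self (decay c) t)
        gcongr
    _ ≤ _ := by
        rw [← mul_assoc]
        gcongr

/-- `R k` is dominated by the solution of `y' = -c_k y + κ_k h_k`, `y(0) = r_k`, on `(0, T)`. -/
def IsDuhamelMajorized (T : ℝ) (c : ι → ℝ) (κ r : ι → ℝ≥0∞) (h R : ι → ℝ → ℝ≥0∞) : Prop :=
  ∀ᵐ t ∂volume.restrict (Ioo 0 T), ∀ k,
    R k t ≤ decay (c k) t * r k + κ k * ∫⁻ s in Ioo 0 T, decay (c k) (t - s) * h k s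

variable {c : ι → ℝ} {κ r : ι → ℝ≥0∞} {h R : ι → ℝ → ℝ≥0∞} {C : ℝ≥0∞}

theorem IsDuhamelMajorized.sq_le (hR : IsDuhamelMajorized T c κ r h R) (hc : ∀ k, 0 ≤ c k)
    (hκ : ∀ k, κ k ^ 2 * ∫⁻ s, decay (c k) s ≤ C)
    (hh : ∀ k, AEMeasurable (h k) (volume.restrict (Ioo 0 T))) :
    ∀ᵐ t ∂volume.restrict (Ioo 0 T), ∀ k, R k t ^ 2 ≤
      4 * (decay (c k) t * r k ^ 2 + C * ∫⁻ s in Ioo 0 T, decay (c k) (t - s) * h k s ^ 2) := by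
  filter_upwards [hR] with t ht k
  calc R k t ^ 2 ≤ _ := pow_le_pow_left₀ zero_le (ht k) 2
    _ ≤ _ := sq_add_le _ _
    _ ≤ _ := by
        gcongr
        · rw [mul_pow]
          gcongr
          rw [sq]
          exact mul_le_of_le_one_left zero_le (decay_le_one (hc k) t)
        · exact sq_mul_lintegral_decay_le Measure.restrict_le_self (hκ k) t (hh k)

/-- The energy inequality with a Fourier weight `W`. -/
theorem IsDuhamelMajorized.tsum_sq_le [Countable ι] (hR : IsDuhamelMajorized T c κ r h R)
    (hc : ∀ k, 0 ≤ c k)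
    (hκ : ∀ k, κ k ^ 2 * ∫⁻ s, decay (c k) s ≤ C)
    (hh : ∀ k, AEMeasurable (h k) (volume.restrict (Ioo 0 T))) (W : ι → ℝ≥0∞) :
    ∀ᵐ t ∂volume.restrict (Ioo 0 T), ∑' k, W k * R k t ^ 2 ≤
      4 * (∑' k, W k * r k ^ 2 +
        C * ∫⁻ s in Ioo 0 T, (Iio t).indicator (fun s => ∑' k, W k * h k s ^ 2) s) := by
  filter_upwards [hR.sq_le hc hκ hh] with t ht
  have hsum : ∫⁻ s in Ioo 0 T, (Iio t).indicator (fun s => ∑' k, W k * h k s ^ 2) s =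
      ∑' k, ∫⁻ s in Ioo 0 T, (Iio t).indicator (fun s => W k * h k s ^ 2) s := by
    rw [← lintegral_tsum fun k =>
      (((hh k).pow_const 2).const_mul (W k)).indicator measurableSet_Iio]
    refine lintegral_congr fun s => ?_
    by_cases hs : s ∈ Iio t
    · simp only [indicator_of_mem hs]
    · simp only [indicator_of_notMem hs, tsum_zero]
  rw [hsum, ← ENNReal.tsum_mul_left, ← ENNReal.tsum_add, ← ENNReal.tsum_mul_left]
  refine ENNReal.tsum_le_tsum fun k => ?_
  calc W k * R k t ^ 2 ≤ W k * (4 * (decay (c k) t * r k ^ 2 +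
        C * ∫⁻ s in Ioo 0 T, decay (c k) (t - s) * h k s ^ 2)) := by gcongr; exact ht k
    _ = 4 * (W k * (decay (c k) t * r k ^ 2) +
        C * (W k * ∫⁻ s in Ioo 0 T, decay (c k) (t - s) * h k s ^ 2)) := by ring
    _ ≤ _ := by
        gcongr
        · exact mul_le_of_le_one_left zero_le (decay_le_one (hc k) t)
        · rw [← lintegral_const_mul'' _ (aemeasurable_decay_mul _ _ ((hh k).pow_const 2))]
          refine lintegral_mono fun s => ?_
          by_cases hs : s < t
          · rw [indicator_of_mem (by exact hs)]
            gcongr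
            exact mul_le_of_le_one_left zero_le (decay_le_one (hc k) _)
          · rw [decay_of_nonpos (sub_nonpos.2 (not_lt.1 hs))]
            simp

theorem aemeasurable_tsum_mul_sq [Countable ι]
    (hh : ∀ k, AEMeasurable (h k) (volume.restrict (Ioo 0 T)))
    (W : ι → ℝ≥0∞) :
    AEMeasurable (fun s => ∑' k, W k * h k s ^ 2) (volume.restrict (Ioo 0 T)) :=
  AEMeasurable.tsum fun k => ((hh k).pow_const 2).const_mul (W k)

/-- The gain of one derivative, square integrably in time. -/
theorem IsDuhamelMajorized.lintegral_tsum_sq_le [Countable ι]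
    (hR : IsDuhamelMajorized T c κ r h R) (hc : ∀ k, 0 ≤ c k)
    (hκ : ∀ k, κ k ^ 2 * ∫⁻ s, decay (c k) s ≤ C)
    (hh : ∀ k, AEMeasurable (h k) (volume.restrict (Ioo 0 T)))
    (hRm : ∀ k, AEMeasurable (R k) (volume.restrict (Ioo 0 T))) (W : ι → ℝ≥0∞) :
    ∫⁻ t in Ioo 0 T, ∑' k, κ k ^ 2 * W k * R k t ^ 2 ≤
      4 * (C * ∑' k, W k * r k ^ 2 + C * (C * ∫⁻ s in Ioo 0 T, ∑' k, W k * h k s ^ 2)) := by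
  set μ := volume.restrict (Ioo 0 T) with hμ
  rw [lintegral_tsum fun k => ((hRm k).pow_const 2).const_mul _,
    lintegral_tsum fun k => ((hh k).pow_const 2).const_mul _]
  simp only [← ENNReal.tsum_mul_left, ← ENNReal.tsum_add]
  refine ENNReal.tsum_le_tsum fun k => ?_
  have hprod : AEMeasurable (Function.uncurry fun t s => decay (c k) (t - s) * h k s ^ 2)
      (μ.prod μ) :=
    ((measurable_decay (c k)).comp (measurable_fst.sub measurable_snd)).aemeasurable.mul
      (((hh k).pow_const 2).comp_snd)
  have hinner : κ k ^ 2 * ∫⁻ t, ∫⁻ s, decay (c k) (t - s) * h k s ^ 2 ∂μ ∂μ ≤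
      C * ∫⁻ s, h k s ^ 2 ∂μ := by
    have hswap : AEMeasurable (fun s => ∫⁻ t, decay (c k) (t - s) * h k s ^ 2 ∂μ) μ :=
      hprod.prod_swap.lintegral_prod_right'
    rw [lintegral_lintegral_swap hprod, ← lintegral_const_mul'' _ hswap,
      ← lintegral_const_mul'' _ ((hh k).pow_const 2)]
    refine lintegral_mono fun s => ?_
    have hmd : Measurable fun t => decay (c k) (t - s) :=
      (measurable_decay (c k)).comp (measurable_id.sub measurable_const)
    rw [lintegral_mul_const _ hmd, ← mul_assoc]
    have hle : ∫⁻ t, decay (c k) (t - s) ∂μ ≤ ∫⁻ t, decay (c k) t :=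
      (lintegral_mono' Measure.restrict_le_self le_rfl).trans_eq
        (lintegral_sub_right_eq_self (decay (c k)) s)
    gcongr
    exact (mul_le_mul_right hle _).trans (hκ k)
  calc ∫⁻ t, κ k ^ 2 * W k * R k t ^ 2 ∂μ
      ≤ ∫⁻ t, κ k ^ 2 * W k * (4 * (decay (c k) t * r k ^ 2 +
          C * ∫⁻ s, decay (c k) (t - s) * h k s ^ 2 ∂μ)) ∂μ := by
        refine lintegral_mono_ae ?_
        filter_upwards [hR.sq_le hc hκ hh] with t ht
        gcongr
        exact ht k
    _ = 4 * (W k * r k ^ 2 * (κ k ^ 2 * ∫⁻ t, decay (c k) t ∂μ) +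
          C * W k * (κ k ^ 2 * ∫⁻ t, ∫⁻ s, decay (c k) (t - s) * h k s ^ 2 ∂μ ∂μ)) := by
        have hm1 : AEMeasurable (fun t => decay (c k) t * r k ^ 2) μ :=
          ((measurable_decay _).mul_const _).aemeasurable
        have hm2 : AEMeasurable (fun t => ∫⁻ s, decay (c k) (t - s) * h k s ^ 2 ∂μ) μ :=
          hprod.lintegral_prod_right'
        have hm3 : AEMeasurable (fun t => decay (c k) t * r k ^ 2 +
            C * ∫⁻ s, decay (c k) (t - s) * h k s ^ 2 ∂μ) μ := hm1.add (hm2.const_mul C)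
        rw [lintegral_const_mul'' _ (hm3.const_mul 4), lintegral_const_mul'' _ hm3,
          lintegral_add_left' hm1,
          lintegral_const_mul'' _ hm2, lintegral_mul_const _ (measurable_decay _)]
        ring
    _ ≤ 4 * (W k * r k ^ 2 * C + C * W k * (C * ∫⁻ s, h k s ^ 2 ∂μ)) := by
        gcongr
        refine le_trans ?_ (hκ k)
        gcongr
        exact Measure.restrict_le_self
    _ = _ := by
        rw [lintegral_const_mul'' _ ((hh k).pow_const 2)]
        ring

end Parabolic

end MLAlpha

namespace MLAlpha

open Set
open scoped ENNReal NNReal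

/-! ### The bootstrap -/

section Bootstrap

variable {ι : Type*} [AddCommGroup ι] [Countable ι] {T : ℝ}

/-- The inequality satisfied by the moduli `R k` of the Fourier coefficients of a solution: the
Duhamel formula for the heat flow with rates `c k`, forced by the divergence of the quadratic term
and by a time-independent force `H`. The weight is `J = 1 + κ²`. -/
structure IsSolutionMajorant (T : ℝ) (J κ r H : ι → ℝ≥0∞) (c : ι → ℝ) (C A : ℝ≥0∞)
    (R : ι → ℝ → ℝ≥0∞) : Prop where
  weight : IsFrequencyWeight J
  weight_eq : ∀ k, J k = 1 + κ k ^ 2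
  rate_nonneg : ∀ k, 0 ≤ c k
  smoothing : ∀ k, κ k ^ 2 * ∫⁻ s, decay (c k) s ≤ C
  smoothing_ne_top : C ≠ ⊤
  const_ne_top : A ≠ ⊤
  aemeasurable : ∀ k, AEMeasurable (R k) (volume.restrict (Ioo 0 T))
  majorized : IsDuhamelMajorized T c κ r
    (fun k s => A * (smoothedConv J (fun l => R l s) k + H k)) R
  lintegral_ne_top : ∫⁻ s in Ioo 0 T, ∑' k, R k s ^ 2 ≠ ⊤

variable {J κ r H : ι → ℝ≥0∞} {c : ι → ℝ} {C A : ℝ≥0∞} {R : ι → ℝ → ℝ≥0∞}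

namespace IsSolutionMajorant

theorem aemeasurable_smoothedConv (h : IsSolutionMajorant T J κ r H c C A R) (k : ι) :
    AEMeasurable (fun s => smoothedConv J (fun l => R l s) k) (volume.restrict (Ioo 0 T)) :=
  AEMeasurable.tsum fun l => (h.aemeasurable l).mul ((h.aemeasurable (k - l)).mul_const _)

theorem aemeasurable_forcing (h : IsSolutionMajorant T J κ r H c C A R) (k : ι) :
    AEMeasurable (fun s => A * (smoothedConv J (fun l => R l s) k + H k))
      (volume.restrict (Ioo 0 T)) :=
  ((h.aemeasurable_smoothedConv k).add_const _).const_mul A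

omit [AddCommGroup ι] [Countable ι] in
theorem tsum_mul_forcing_sq_le (A : ℝ≥0∞) (G H W : ι → ℝ≥0∞) :
    ∑' k, W k * (A * (G k + H k)) ^ 2 ≤
      4 * A ^ 2 * (∑' k, W k * G k ^ 2 + ∑' k, W k * H k ^ 2) := by
  rw [← ENNReal.tsum_add, ← ENNReal.tsum_mul_left]
  refine ENNReal.tsum_le_tsum fun k => ?_
  calc W k * (A * (G k + H k)) ^ 2 ≤ W k * (A ^ 2 * (4 * (G k ^ 2 + H k ^ 2))) := by
        rw [mul_pow]
        gcongr
        exact sq_add_le _ _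
    _ = _ := by ring

omit [Countable ι] in
theorem tsum_smoothedConv_sq_le (h : IsFrequencyWeight J) (f : ι → ℝ≥0∞) :
    ∑' k, smoothedConv J f k ^ 2 ≤ (2 * ∑' k, (J k)⁻¹ ^ 2) * (∑' k, f k ^ 2) ^ 2 := by
  have := tsum_pow_mul_smoothedConv_sq_le h 0 f
  simpa only [pow_zero, one_mul, mul_one, ← sq] using this

/-- The solution is bounded in time with values in `H⁻¹`. The quadratic term is only `L¹` in time
with values in `L²`, and Minkowski's inequality enters in the form of a Cauchy–Schwarz inequality
with the weight `1 + ‖u(s)‖²`. -/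
theorem exists_ae_tsum_inv_mul_sq_le (h : IsSolutionMajorant T J κ r H c C A R)
    (hr : ∑' k, r k ^ 2 ≠ ⊤) (hH : ∑' k, H k ^ 2 ≠ ⊤) :
    ∃ M : ℝ≥0∞, M ≠ ⊤ ∧
      ∀ᵐ t ∂volume.restrict (Ioo 0 T), ∑' k, (J k)⁻¹ * R k t ^ 2 ≤ M := by
  set μ := volume.restrict (Ioo 0 T) with hμ
  set S := ∑' k, (J k)⁻¹ ^ 2 with hS
  let f : ι → ℝ → ℝ≥0∞ := fun k s => A * (smoothedConv J (fun l => R l s) k + H k)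
  have hf : ∀ k, AEMeasurable (f k) μ := h.aemeasurable_forcing
  let B : ℝ → ℝ≥0∞ := fun s => ∑' k, R k s ^ 2
  have hB : AEMeasurable B μ := AEMeasurable.tsum fun k => (h.aemeasurable k).pow_const 2
  let g : ℝ → ℝ≥0∞ := fun s => 1 + B s
  have hg : AEMeasurable g μ := hB.const_add 1
  have hvol : μ univ ≠ ⊤ := by simp [hμ]
  have hgi : ∫⁻ s, g s ∂μ ≠ ⊤ := by
    rw [lintegral_add_left measurable_const, lintegral_const]
    exact ENNReal.add_ne_top.2 ⟨ENNReal.mul_ne_top (by simp) hvol, h.lintegral_ne_top⟩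
  have hgtop : ∀ᵐ s ∂μ, g s ≠ ⊤ := (ae_lt_top' hg hgi).mono fun s hs => hs.ne
  have hg0 : ∀ s, g s ≠ 0 := fun s => by simp [g]
  -- the integrated forcing is square summable
  set Q := ∫⁻ s, 4 * A ^ 2 * (2 * S * g s + ∑' k, H k ^ 2) ∂μ with hQ
  have hQtop : Q ≠ ⊤ := by
    rw [hQ, lintegral_const_mul'' _ ((hg.const_mul _).add_const _),
      lintegral_add_right _ measurable_const, lintegral_const_mul'' _ hg, lintegral_const]
    have hA := h.const_ne_top
    have hS' : S ≠ ⊤ := h.weight.tsum_ne_top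
    finiteness
  have hint : ∑' k, (∫⁻ s, f k s ∂μ) ^ 2 ≤ (∫⁻ s, g s ∂μ) * Q := by
    have h1 : ∀ k, (∫⁻ s, f k s ∂μ) ^ 2 ≤ (∫⁻ s, g s ∂μ) * ∫⁻ s, (g s)⁻¹ * f k s ^ 2 ∂μ := by
      intro k
      have := sq_lintegral_le_weight hg (hg.inv.mul (hf k))
      simp only [Pi.mul_apply, Pi.inv_apply] at this
      have e1 : ∫⁻ s, g s * ((g s)⁻¹ * f k s) ∂μ = ∫⁻ s, f k s ∂μ := by
        refine lintegral_congr_ae ?_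
        filter_upwards [hgtop] with s hs
        rw [← mul_assoc, ENNReal.mul_inv_cancel (hg0 s) hs, one_mul]
      have e2 : ∫⁻ s, g s * ((g s)⁻¹ * f k s) ^ 2 ∂μ = ∫⁻ s, (g s)⁻¹ * f k s ^ 2 ∂μ := by
        refine lintegral_congr_ae ?_
        filter_upwards [hgtop] with s hs
        rw [mul_pow, sq (g s)⁻¹, mul_assoc, ← mul_assoc (g s), ENNReal.mul_inv_cancel (hg0 s) hs,
          one_mul]
      rwa [e1, e2] at this
    calc ∑' k, (∫⁻ s, f k s ∂μ) ^ 2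
        ≤ ∑' k, (∫⁻ s, g s ∂μ) * ∫⁻ s, (g s)⁻¹ * f k s ^ 2 ∂μ := ENNReal.tsum_le_tsum h1
      _ = (∫⁻ s, g s ∂μ) * ∫⁻ s, ∑' k, (g s)⁻¹ * f k s ^ 2 ∂μ := by
        have hm : ∀ k, AEMeasurable (fun s => (g s)⁻¹ * f k s ^ 2) μ := fun k =>
          hg.inv.mul ((hf k).pow_const 2)
        rw [ENNReal.tsum_mul_left, lintegral_tsum hm]
      _ ≤ (∫⁻ s, g s ∂μ) * Q := by
        refine mul_le_mul_right (lintegral_mono_ae ?_) _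
        filter_upwards [hgtop] with s hs
        have e := tsum_mul_forcing_sq_le A (smoothedConv J fun l => R l s) H (fun _ => (g s)⁻¹)
        refine e.trans ?_
        gcongr
        · rw [ENNReal.tsum_mul_left]
          calc (g s)⁻¹ * ∑' k, smoothedConv J (fun l => R l s) k ^ 2
              ≤ (g s)⁻¹ * (2 * S * g s ^ 2) := by
                gcongr
                refine (tsum_smoothedConv_sq_le h.weight _).trans ?_
                gcongr
                exact le_add_self
            _ = 2 * S * g s * ((g s)⁻¹ * g s) := by ring
            _ = _ := by rw [ENNReal.inv_mul_cancel (hg0 s) hs, mul_one]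
        · refine mul_le_of_le_one_left zero_le (ENNReal.inv_le_one.2 ?_)
          exact le_self_add
  refine ⟨4 * (∑' k, r k ^ 2 + (∫⁻ s, g s ∂μ) * Q), by finiteness, ?_⟩
  filter_upwards [h.majorized] with t ht
  calc ∑' k, (J k)⁻¹ * R k t ^ 2 ≤ ∑' k, 4 * (r k ^ 2 + (∫⁻ s, f k s ∂μ) ^ 2) := by
        refine ENNReal.tsum_le_tsum fun k => ?_
        have hJ1 : (J k)⁻¹ ≤ 1 := ENNReal.inv_le_one.2 (h.weight.one_le k)
        have hJκ : (J k)⁻¹ * κ k ^ 2 ≤ 1 := by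
          rw [← ENNReal.inv_mul_cancel (h.weight.ne_zero k) (h.weight.ne_top k)]
          gcongr
          rw [h.weight_eq k]
          exact le_add_self
        have hRk : R k t ≤ r k + κ k * ∫⁻ s, f k s ∂μ := by
          refine (ht k).trans ?_
          gcongr
          · exact mul_le_of_le_one_left zero_le (decay_le_one (h.rate_nonneg k) t)
          · exact mul_le_of_le_one_left zero_le (decay_le_one (h.rate_nonneg k) _)
        calc (J k)⁻¹ * R k t ^ 2
            ≤ (J k)⁻¹ * (4 * (r k ^ 2 + (κ k * ∫⁻ s, f k s ∂μ) ^ 2)) := by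
              gcongr
              exact (pow_le_pow_left₀ zero_le hRk 2).trans (sq_add_le _ _)
          _ = 4 * ((J k)⁻¹ * r k ^ 2 + ((J k)⁻¹ * κ k ^ 2) * (∫⁻ s, f k s ∂μ) ^ 2) := by ring
          _ ≤ 4 * (1 * r k ^ 2 + 1 * (∫⁻ s, f k s ∂μ) ^ 2) := by gcongr
          _ = _ := by rw [one_mul, one_mul]
    _ ≤ _ := by
        rw [ENNReal.tsum_mul_left, ENNReal.tsum_add]
        gcongr

/-- The solution is bounded in time with values in `L²`: Gronwall's inequality for the norms with
weight `(1 + ε J)⁻¹`, which are finite by the `H⁻¹` bound, gives a bound uniform in `ε`. -/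
theorem exists_ae_tsum_sq_le (h : IsSolutionMajorant T J κ r H c C A R)
    (hr : ∑' k, r k ^ 2 ≠ ⊤) (hH : ∑' k, H k ^ 2 ≠ ⊤) :
    ∃ M : ℝ≥0∞, M ≠ ⊤ ∧ ∀ᵐ t ∂volume.restrict (Ioo 0 T), ∑' k, R k t ^ 2 ≤ M := by
  obtain ⟨M, hM, hRM⟩ := h.exists_ae_tsum_inv_mul_sq_le hr hH
  set μ := volume.restrict (Ioo 0 T) with hμ
  set S := ∑' k, (J k)⁻¹ ^ 2 with hS
  have hA := h.const_ne_top
  have hC := h.smoothing_ne_top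
  have hSt : S ≠ ⊤ := h.weight.tsum_ne_top
  have hvol : μ univ ≠ ⊤ := by simp [hμ]
  have hBm : AEMeasurable (fun s => ∑' k, R k s ^ 2) μ :=
    AEMeasurable.tsum fun k => (h.aemeasurable k).pow_const 2
  set b : ℝ≥0∞ := 4 * (C * (4 * A ^ 2 * (8 * S))) with hb
  have hbt : b ≠ ⊤ := by finiteness
  obtain ⟨D, hD, hgron⟩ := exists_gronwall (T := T) (B := fun s => b * ∑' k, R k s ^ 2)
    (hBm.const_mul b) (by
      rw [lintegral_const_mul'' _ hBm]
      exact ENNReal.mul_ne_top hbt h.lintegral_ne_top)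
  set A₀ : ℝ≥0∞ := 4 * (∑' k, r k ^ 2 + C * (4 * A ^ 2 * (∑' k, H k ^ 2) * μ univ)) with hA₀
  have hA₀t : A₀ ≠ ⊤ := by finiteness
  have hε : ∀ ε : ℝ≥0, 0 < ε → ∀ᵐ t ∂μ, ∑' k, (1 + ε * J k)⁻¹ * R k t ^ 2 ≤ D * A₀ := by
    intro ε hε0
    have hW1 : ∀ k, (1 + ε * J k)⁻¹ ≤ 1 := fun k => ENNReal.inv_le_one.2 le_self_add
    refine hgron _ A₀ ((ε : ℝ≥0∞)⁻¹ * M) (ENNReal.mul_ne_top (by simpa using hε0.ne') hM) ?_ ?_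
    · filter_upwards [hRM] with t ht
      refine le_trans ?_ (mul_le_mul_right ht _)
      rw [← ENNReal.tsum_mul_left]
      refine ENNReal.tsum_le_tsum fun k => ?_
      rw [← mul_assoc, ← ENNReal.mul_inv (Or.inr (h.weight.ne_top k)) (Or.inl (by simp))]
      gcongr
      exact le_add_self
    · filter_upwards [h.majorized.tsum_sq_le h.rate_nonneg h.smoothing h.aemeasurable_forcing
        (fun k => (1 + ε * J k)⁻¹)] with t ht
      refine ht.trans ?_
      have hpt : ∀ s, (Iio t).indicator (fun s => ∑' k, (1 + ε * J k)⁻¹ *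
          (A * (smoothedConv J (fun l => R l s) k + H k)) ^ 2) s ≤
          4 * A ^ 2 * (8 * S) * (Iio t).indicator
            (fun s => (∑' k, R k s ^ 2) * ∑' k, (1 + ε * J k)⁻¹ * R k s ^ 2) s +
          4 * A ^ 2 * ∑' k, H k ^ 2 := by
        intro s
        by_cases hs : s ∈ Iio t
        · rw [indicator_of_mem hs, indicator_of_mem hs]
          refine (tsum_mul_forcing_sq_le A _ H _).trans ?_
          rw [mul_add, mul_assoc (4 * A ^ 2) (8 * S)]
          gcongr
          · exact tsum_inv_mul_smoothedConv_sq_le h.weight ε _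
          · exact mul_le_of_le_one_left zero_le (hW1 _)
        · rw [indicator_of_notMem hs]
          exact zero_le
      have hXm : AEMeasurable (fun s => (Iio t).indicator
          (fun s => (∑' k, R k s ^ 2) * ∑' k, (1 + ε * J k)⁻¹ * R k s ^ 2) s) μ :=
        (hBm.mul (aemeasurable_tsum_mul_sq h.aemeasurable _)).indicator measurableSet_Iio
      calc 4 * (∑' k, (1 + ε * J k)⁻¹ * r k ^ 2 + C * ∫⁻ s, (Iio t).indicator
            (fun s => ∑' k, (1 + ε * J k)⁻¹ *
              (A * (smoothedConv J (fun l => R l s) k + H k)) ^ 2) s ∂μ)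
          ≤ 4 * (∑' k, r k ^ 2 + C * ∫⁻ s, (4 * A ^ 2 * (8 * S) * (Iio t).indicator
            (fun s => (∑' k, R k s ^ 2) * ∑' k, (1 + ε * J k)⁻¹ * R k s ^ 2) s +
            4 * A ^ 2 * ∑' k, H k ^ 2) ∂μ) := by
            gcongr
            · exact mul_le_of_le_one_left zero_le (hW1 _)
            · exact hpt _
        _ = A₀ + b * ∫⁻ s, (Iio t).indicator
            (fun s => (∑' k, R k s ^ 2) * ∑' k, (1 + ε * J k)⁻¹ * R k s ^ 2) s ∂μ := by
            rw [lintegral_add_right _ measurable_const, lintegral_const_mul'' _ hXm,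
              lintegral_const, hA₀, hb]
            ring
        _ = _ := by
            rw [← lintegral_const_mul'' _ hXm]
            congr 1
            refine lintegral_congr fun s => ?_
            by_cases hs : s ∈ Iio t
            · simp only [indicator_of_mem hs, mul_assoc]
            · simp only [indicator_of_notMem hs, mul_zero]
  refine ⟨2 * (D * A₀), by finiteness, ?_⟩
  have hall : ∀ᵐ t ∂μ, ∀ n : ℕ,
      ∑' k, (1 + ((n + 1 : ℝ≥0)⁻¹ : ℝ≥0) * J k)⁻¹ * R k t ^ 2 ≤ D * A₀ :=
    ae_all_iff.2 fun n => hε _ (by positivity)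
  filter_upwards [hall] with t ht
  rw [ENNReal.tsum_eq_iSup_sum]
  refine iSup_le fun F => ?_
  -- on a finite set of frequencies the weight is at least `1 / 2` when `ε` is small
  obtain ⟨n, hn⟩ : ∃ n : ℕ, ∀ k ∈ F, J k ≤ n := by
    obtain ⟨n, hn⟩ := ENNReal.exists_nat_gt (r := ∑ k ∈ F, J k)
      (ENNReal.sum_ne_top.2 fun k _ => h.weight.ne_top k)
    exact ⟨n, fun k hk => (Finset.single_le_sum (fun _ _ => zero_le) hk).trans hn.le⟩
  have hw : ∀ k ∈ F, 2⁻¹ ≤ (1 + ((n + 1 : ℝ≥0)⁻¹ : ℝ≥0) * J k)⁻¹ := by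
    intro k hk
    refine ENNReal.inv_le_inv.2 ?_
    rw [← one_add_one_eq_two]
    gcongr
    rw [ENNReal.coe_inv (by positivity)]
    refine (mul_le_mul_right ((hn k hk).trans ?_) _).trans (ENNReal.inv_mul_le_one _)
    push_cast
    exact le_self_add
  calc ∑ k ∈ F, R k t ^ 2 = 2 * ∑ k ∈ F, 2⁻¹ * R k t ^ 2 := by
        rw [← Finset.mul_sum, ← mul_assoc, ENNReal.mul_inv_cancel (by simp) (by simp), one_mul]
    _ ≤ 2 * ∑ k ∈ F, (1 + ((n + 1 : ℝ≥0)⁻¹ : ℝ≥0) * J k)⁻¹ * R k t ^ 2 := by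
        exact mul_le_mul_right
          (Finset.sum_le_sum fun k hk => mul_le_mul_left (hw k hk) _) _
    _ ≤ 2 * (D * A₀) := by
        gcongr
        exact (ENNReal.sum_le_tsum F).trans (ht n)

omit [AddCommGroup ι] [Countable ι] in
theorem tsum_pow_mul_sq_ne_top {J f : ι → ℝ≥0∞} (hJ : ∀ k, 1 ≤ J k) {s m : ℕ} (hsm : s ≤ m)
    (hf : ∑' k, J k ^ m * f k ^ 2 ≠ ⊤) : ∑' k, J k ^ s * f k ^ 2 ≠ ⊤ :=
  ne_top_of_le_ne_top hf <| ENNReal.tsum_le_tsum fun k =>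
    mul_le_mul_left (pow_le_pow_right₀ (hJ k) hsm) _

theorem lintegral_tsum_smoothedConv_sq_ne_top (h : IsSolutionMajorant T J κ r H c C A R)
    (hr : ∑' k, r k ^ 2 ≠ ⊤) (hH : ∑' k, H k ^ 2 ≠ ⊤) {s : ℕ}
    (hR : ∫⁻ t in Ioo 0 T, ∑' k, J k ^ s * R k t ^ 2 ≠ ⊤) :
    ∫⁻ t in Ioo 0 T, ∑' k, J k ^ s * smoothedConv J (fun l => R l t) k ^ 2 ≠ ⊤ := by
  obtain ⟨M, hM, hRM⟩ := h.exists_ae_tsum_sq_le hr hH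
  have hS := h.weight.tsum_ne_top
  refine ne_top_of_le_ne_top (b := ∫⁻ t in Ioo 0 T, (2 * 4 ^ s * ∑' k, (J k)⁻¹ ^ 2) *
    (M * ∑' k, J k ^ s * R k t ^ 2)) ?_ (lintegral_mono_ae ?_)
  · rw [lintegral_const_mul'' _ ((aemeasurable_tsum_mul_sq h.aemeasurable _).const_mul M),
      lintegral_const_mul'' _ (aemeasurable_tsum_mul_sq h.aemeasurable _)]
    finiteness
  · filter_upwards [hRM] with t ht
    refine (tsum_pow_mul_smoothedConv_sq_le h.weight s _).trans ?_
    gcongr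

/-- If the quadratic term is square integrable in time with values in `H^s`, then the solution is
bounded with values in `H^s` and square integrable with values in `H^{s+1}`. -/
theorem gain_derivative (h : IsSolutionMajorant T J κ r H c C A R) {s : ℕ}
    (hr : ∑' k, J k ^ s * r k ^ 2 ≠ ⊤) (hH : ∑' k, J k ^ s * H k ^ 2 ≠ ⊤)
    (hG : ∫⁻ t in Ioo 0 T, ∑' k, J k ^ s * smoothedConv J (fun l => R l t) k ^ 2 ≠ ⊤) :
    (∃ M : ℝ≥0∞, M ≠ ⊤ ∧
      ∀ᵐ t ∂volume.restrict (Ioo 0 T), ∑' k, J k ^ s * R k t ^ 2 ≤ M) ∧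
    ∫⁻ t in Ioo 0 T, ∑' k, J k ^ (s + 1) * R k t ^ 2 ≠ ⊤ := by
  set μ := volume.restrict (Ioo 0 T) with hμ
  have hA := h.const_ne_top
  have hC := h.smoothing_ne_top
  have hvol : μ univ ≠ ⊤ := by simp [hμ]
  have hF : ∫⁻ t, ∑' k, J k ^ s * (A * (smoothedConv J (fun l => R l t) k + H k)) ^ 2 ∂μ ≠ ⊤ := by
    refine ne_top_of_le_ne_top ?_ (lintegral_mono fun t => tsum_mul_forcing_sq_le A _ H _)
    have hm : AEMeasurable (fun t => ∑' k, J k ^ s * smoothedConv J (fun l => R l t) k ^ 2) μ :=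
      aemeasurable_tsum_mul_sq h.aemeasurable_smoothedConv _
    rw [lintegral_const_mul'' _ (hm.add_const _), lintegral_add_right _ measurable_const,
      lintegral_const]
    finiteness
  have hbound : ∃ M : ℝ≥0∞, M ≠ ⊤ ∧ ∀ᵐ t ∂μ, ∑' k, J k ^ s * R k t ^ 2 ≤ M := by
    refine ⟨4 * (∑' k, J k ^ s * r k ^ 2 + C *
      ∫⁻ t, ∑' k, J k ^ s * (A * (smoothedConv J (fun l => R l t) k + H k)) ^ 2 ∂μ),
      by finiteness, ?_⟩
    filter_upwards [h.majorized.tsum_sq_le h.rate_nonneg h.smoothing h.aemeasurable_forcing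
      (fun k => J k ^ s)] with t ht
    refine ht.trans ?_
    gcongr with x
    exact indicator_le_self _ _ _
  refine ⟨hbound, ?_⟩
  obtain ⟨M, hM, hRM⟩ := hbound
  have hgain := h.majorized.lintegral_tsum_sq_le h.rate_nonneg h.smoothing h.aemeasurable_forcing
    h.aemeasurable (fun k => J k ^ s)
  have e : ∀ t, ∑' k, J k ^ (s + 1) * R k t ^ 2 =
      ∑' k, J k ^ s * R k t ^ 2 + ∑' k, κ k ^ 2 * J k ^ s * R k t ^ 2 := fun t => by
    rw [← ENNReal.tsum_add]
    refine tsum_congr fun k => ?_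
    rw [pow_succ, h.weight_eq k]
    ring
  simp only [e]
  rw [lintegral_add_left' (aemeasurable_tsum_mul_sq h.aemeasurable _)]
  refine ENNReal.add_ne_top.2 ⟨?_, ne_top_of_le_ne_top (by finiteness) hgain⟩
  refine ne_top_of_le_ne_top ?_ (lintegral_mono_ae hRM)
  rw [lintegral_const]
  finiteness

/-- Regularity of every order allowed by the data. -/
theorem regularity (h : IsSolutionMajorant T J κ r H c C A R) {m : ℕ}
    (hr : ∑' k, J k ^ m * r k ^ 2 ≠ ⊤) (hH : ∑' k, J k ^ m * H k ^ 2 ≠ ⊤) :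
    (∃ M : ℝ≥0∞, M ≠ ⊤ ∧
      ∀ᵐ t ∂volume.restrict (Ioo 0 T), ∑' k, J k ^ m * R k t ^ 2 ≤ M) ∧
    ∫⁻ t in Ioo 0 T, ∑' k, J k ^ (m + 1) * R k t ^ 2 ≠ ⊤ ∧
    ∫⁻ t in Ioo 0 T, ∑' k, J k ^ m * smoothedConv J (fun l => R l t) k ^ 2 ≠ ⊤ := by
  have hr0 : ∑' k, r k ^ 2 ≠ ⊤ := by
    simpa using tsum_pow_mul_sq_ne_top h.weight.one_le (Nat.zero_le m) hr
  have hH0 : ∑' k, H k ^ 2 ≠ ⊤ := by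
    simpa using tsum_pow_mul_sq_ne_top h.weight.one_le (Nat.zero_le m) hH
  have hstep : ∀ s ≤ m, ∫⁻ t in Ioo 0 T, ∑' k, J k ^ s * R k t ^ 2 ≠ ⊤ := by
    intro s
    induction s with
    | zero => intro _; simpa using h.lintegral_ne_top
    | succ s ih =>
      intro hs
      have hs' := Nat.le_of_succ_le hs
      exact (h.gain_derivative (tsum_pow_mul_sq_ne_top h.weight.one_le hs' hr)
        (tsum_pow_mul_sq_ne_top h.weight.one_le hs' hH)
        (h.lintegral_tsum_smoothedConv_sq_ne_top hr0 hH0 (ih hs'))).2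
  have hG := h.lintegral_tsum_smoothedConv_sq_ne_top hr0 hH0 (hstep m le_rfl)
  exact ⟨(h.gain_derivative hr hH hG).1, (h.gain_derivative hr hH hG).2, hG⟩

end IsSolutionMajorant

end Bootstrap

end MLAlpha

namespace Torus3

open Set
open scoped ENNReal NNReal ComplexConjugate

/-! ### Fourier series on the torus -/

variable {P : ℝ}

/-- The wave vector `2πk / P`. -/
noncomputable def waveVec (P : ℝ) (k : Fin 3 → ℤ) (j : Fin 3) : ℝ := 2 * Real.pi * (k j : ℝ) / P

theorem waveSq_eq_sum (k : Fin 3 → ℤ) : waveSq P k = ∑ j, waveVec P k j ^ 2 := rfl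

theorem waveSq_nonneg (k : Fin 3 → ℤ) : 0 ≤ waveSq P k := Finset.sum_nonneg fun _ _ => sq_nonneg _

theorem abs_waveVec_le (k : Fin 3 → ℤ) (j : Fin 3) : |waveVec P k j| ≤ √(waveSq P k) :=
  Real.abs_le_sqrt (Finset.single_le_sum (f := fun j => waveVec P k j ^ 2)
    (fun _ _ => sq_nonneg _) (Finset.mem_univ j))

/-- The exponential `exp(2πi k·x / P)`. -/
noncomputable def mode (P : ℝ) (k : Fin 3 → ℤ) : C(Torus3 P, ℂ) where
  toFun x := ∏ j, fourier (k j) (x j)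
  continuous_toFun := by fun_prop

theorem mode_apply (k : Fin 3 → ℤ) (x : Torus3 P) : mode P k x = ∏ j, fourier (k j) (x j) := rfl

theorem mode_neg (k : Fin 3 → ℤ) (x : Torus3 P) : mode P (-k) x = conj (mode P k x) := by
  simp only [mode_apply, Pi.neg_apply, fourier_neg, map_prod]

theorem mode_add (k l : Fin 3 → ℤ) (x : Torus3 P) :
    mode P (k + l) x = mode P k x * mode P l x := by
  simp only [mode_apply, Pi.add_apply, fourier_add, ← Finset.prod_mul_distrib]

theorem mode_mk (k : Fin 3 → ℤ) (y : Fin 3 → ℝ) :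
    mode P k (mk P y) = Complex.exp (((∑ j, waveVec P k j * y j : ℝ) : ℂ) * Complex.I) := by
  simp only [mode_apply, mk, fourier_coe_apply, ← Complex.exp_sum]
  congr 1
  push_cast
  rw [Finset.sum_mul]
  refine Finset.sum_congr rfl fun j _ => ?_
  simp only [waveVec]
  push_cast
  ring

theorem mk_surjective (P : ℝ) : Function.Surjective (mk P) := fun x =>
  ⟨fun j => (QuotientAddGroup.mk_surjective (x j)).choose,
    funext fun j => (QuotientAddGroup.mk_surjective (x j)).choose_spec⟩

theorem norm_mode_apply (k : Fin 3 → ℤ) (x : Torus3 P) : ‖mode P k x‖ = 1 := by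
  obtain ⟨y, rfl⟩ := mk_surjective P x
  rw [mode_mk, Complex.norm_exp_ofReal_mul_I]

variable [hP : Fact (0 < P)]

theorem fourierCoeff_eq (g : Torus3 P → ℝ) (k : Fin 3 → ℤ) :
    fourierCoeff g k = ((P : ℂ) ^ 3)⁻¹ * ∫ x, mode P (-k) x * (g x : ℂ) := rfl

theorem integral_fourier_eq (n : ℤ) :
    ∫ x : AddCircle P, fourier n x = if n = 0 then (P : ℂ) else 0 := by
  have h := congrFun (fourierCoeff_fourier (T := P) n) 0
  rw [_root_.fourierCoeff] at h
  simp only [neg_zero, fourier_zero, one_smul] at h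
  rw [AddCircle.volume_eq_smul_haarAddCircle, integral_smul_measure, h,
    ENNReal.toReal_ofReal hP.out.le]
  rcases eq_or_ne n 0 with rfl | hn
  · simp
  · simp [hn, hn.symm]

theorem integral_mode (k : Fin 3 → ℤ) :
    ∫ x, mode P k x = if k = 0 then (P : ℂ) ^ 3 else 0 := by
  simp only [mode_apply]
  rw [integral_fintype_prod_volume_eq_prod (fun j => fun x : AddCircle P => fourier (k j) x)]
  simp only [integral_fourier_eq]
  split_ifs with h
  · simp [h]
  · obtain ⟨j, hj⟩ := Function.ne_iff.1 h
    exact Finset.prod_eq_zero (Finset.mem_univ j) (if_neg (by simpa using hj))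

/-- The trigonometric polynomials, as a star subalgebra of the continuous functions. -/
noncomputable def modeSubalgebra (P : ℝ) [Fact (0 < P)] : StarSubalgebra ℂ C(Torus3 P, ℂ) where
  toSubalgebra := Algebra.adjoin ℂ (range (mode P))
  star_mem' := by
    change Algebra.adjoin ℂ (range (mode P)) ≤ star (Algebra.adjoin ℂ (range (mode P)))
    refine Algebra.adjoin_le ?_
    rintro _ ⟨n, rfl⟩
    refine Algebra.subset_adjoin ⟨-n, ?_⟩
    ext1 x
    simp only [mode_neg, starRingEnd_apply, ContinuousMap.star_apply]

/-- Products of exponentials are exponentials, so that the algebra they generate is their span. -/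
theorem modeSubalgebra_coe :
    Subalgebra.toSubmodule (modeSubalgebra P).toSubalgebra = Submodule.span ℂ (range (mode P)) := by
  apply Algebra.adjoin_eq_span_of_subset
  refine .trans (fun x => Submonoid.closure_induction (fun _ => id) ⟨0, ?_⟩ ?_)
    Submodule.subset_span
  · ext z
    simp [mode_apply]
  · rintro _ _ _ _ ⟨m, rfl⟩ ⟨n, rfl⟩
    refine ⟨m + n, ?_⟩
    ext z
    exact mode_add m n z

theorem modeSubalgebra_separatesPoints : (modeSubalgebra P).SeparatesPoints := by
  intro x y hxy
  rw [Ne, funext_iff, not_forall] at hxy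
  obtain ⟨i, hi⟩ := hxy
  refine ⟨_, ⟨mode P (Pi.single i 1), Algebra.subset_adjoin ⟨Pi.single i 1, rfl⟩, rfl⟩, ?_⟩
  have hs : ∀ z : Torus3 P, mode P (Pi.single i 1) z = fourier 1 (z i) := fun z => by
    rw [mode_apply, Finset.prod_eq_single i]
    · rw [Pi.single_eq_same]
    · intro j _ hj
      rw [Pi.single_eq_of_ne hj, fourier_zero]
    · simp
  dsimp only
  rw [hs, hs, fourier_one, fourier_one]
  contrapose hi
  exact AddCircle.injective_toCircle hP.out.ne' (Circle.coe_injective hi)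

theorem span_mode_closure_eq_top :
    (Submodule.span ℂ (range (mode P))).topologicalClosure = ⊤ := by
  rw [← modeSubalgebra_coe]
  exact congr_arg (Subalgebra.toSubmodule <| StarSubalgebra.toSubalgebra ·)
    (ContinuousMap.starSubalgebra_topologicalClosure_eq_top_of_separatesPoints _
      modeSubalgebra_separatesPoints)

/-- The normalized exponentials `P^{-3/2} exp(2πi k·x / P)` in `L²`. -/
noncomputable def modeLp (P : ℝ) [Fact (0 < P)] (k : Fin 3 → ℤ) :
    Lp ℂ 2 (volume : Measure (Torus3 P)) :=
  (((√(P ^ 3))⁻¹ : ℝ) : ℂ) • ContinuousMap.toLp (E := ℂ) 2 volume ℂ (mode P k)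

theorem sqrt_cube_inv_sq : ((√(P ^ 3))⁻¹ : ℝ) * (√(P ^ 3))⁻¹ * P ^ 3 = 1 := by
  have h : (0 : ℝ) < P ^ 3 := pow_pos hP.out 3
  rw [← mul_inv, Real.mul_self_sqrt h.le, inv_mul_cancel₀ h.ne']

theorem orthonormal_modeLp : Orthonormal ℂ (modeLp P) := by
  rw [orthonormal_iff_ite]
  intro k l
  simp only [modeLp, inner_smul_left, inner_smul_right, ContinuousMap.inner_toLp,
    Complex.conj_ofReal]
  have h : ∫ x, mode P l x * conj (mode P k x) = if k = l then (P : ℂ) ^ 3 else 0 := by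
    simp only [← mode_neg, ← mode_add]
    rw [integral_mode]
    simp only [add_neg_eq_zero, eq_comm]
  rw [h]
  split_ifs
  · rw [← mul_assoc]
    exact_mod_cast sqrt_cube_inv_sq (P := P)
  · simp

theorem span_modeLp_closure_eq_top :
    (Submodule.span ℂ (range (modeLp P))).topologicalClosure = ⊤ := by
  have h : (Submodule.span ℂ (range fun k => ContinuousMap.toLp (E := ℂ) 2
      (volume : Measure (Torus3 P)) ℂ (mode P k))).topologicalClosure = ⊤ := by
    simpa only [Submodule.map_span, ContinuousLinearMap.coe_coe, ← range_comp,
      Function.comp_def] using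
      (ContinuousMap.toLp_denseRange ℂ (volume : Measure (Torus3 P)) ℂ
        (by simp : (2 : ℝ≥0∞) ≠ ⊤)).topologicalClosure_map_submodule span_mode_closure_eq_top
  rw [eq_top_iff, ← h]
  refine Submodule.topologicalClosure_mono (Submodule.span_le.2 ?_)
  rintro _ ⟨k, rfl⟩
  have hc : (((√(P ^ 3))⁻¹ : ℝ) : ℂ) ≠ 0 := by
    have : (0 : ℝ) < P ^ 3 := pow_pos hP.out 3
    exact_mod_cast (inv_pos.2 (Real.sqrt_pos.2 this)).ne'
  rw [SetLike.mem_coe, ← Submodule.smul_mem_iff _ hc]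
  exact Submodule.subset_span ⟨k, rfl⟩

/-- The Hilbert basis of normalized exponentials. -/
noncomputable def modeBasis (P : ℝ) [Fact (0 < P)] :
    HilbertBasis (Fin 3 → ℤ) ℂ (Lp ℂ 2 (volume : Measure (Torus3 P))) :=
  HilbertBasis.mk orthonormal_modeLp span_modeLp_closure_eq_top.ge

theorem coe_modeBasis : ⇑(modeBasis P) = modeLp P := HilbertBasis.coe_mk _ _

theorem coeFn_modeLp (k : Fin 3 → ℤ) :
    modeLp P k =ᵐ[volume] fun x => (((√(P ^ 3))⁻¹ : ℝ) : ℂ) * mode P k x := by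
  filter_upwards [Lp.coeFn_smul (((√(P ^ 3))⁻¹ : ℝ) : ℂ)
    (ContinuousMap.toLp (E := ℂ) 2 volume ℂ (mode P k)),
    ContinuousMap.coeFn_toLp (𝕜 := ℂ) (p := 2) (volume : Measure (Torus3 P)) (mode P k)]
    with x h1 h2
  rw [modeLp, h1, Pi.smul_apply, h2, smul_eq_mul]

/-- The Fourier coefficient without its normalization. -/
theorem integral_mode_mul (g : Torus3 P → ℝ) (k : Fin 3 → ℤ) :
    ∫ x, mode P (-k) x * (g x : ℂ) = (P : ℂ) ^ 3 * fourierCoeff g k := by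
  have h : (P : ℂ) ^ 3 ≠ 0 := pow_ne_zero 3 (by exact_mod_cast hP.out.ne')
  rw [fourierCoeff_eq, ← mul_assoc, mul_inv_cancel₀ h, one_mul]

theorem memLp_ofReal {g : Torus3 P → ℝ} (hg : MemLp g 2 volume) :
    MemLp (fun x => (g x : ℂ)) 2 volume := hg.ofReal

theorem memLp_mode_mul {g : Torus3 P → ℝ} (hg : MemLp g 2 volume) (k : Fin 3 → ℤ) :
    MemLp (fun x => mode P k x * (g x : ℂ)) 2 volume := by
  refine (memLp_ofReal hg).of_le
    ((mode P k).continuous.aestronglyMeasurable.mul (memLp_ofReal hg).1) ?_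
  exact Filter.Eventually.of_forall fun x => by simp [norm_mode_apply]

theorem inner_modeLp_toLp {g : Torus3 P → ℝ} (hg : MemLp g 2 volume) (k : Fin 3 → ℤ) :
    inner ℂ (modeLp P k) (memLp_ofReal hg).toLp =
      (((√(P ^ 3))⁻¹ : ℝ) : ℂ) * ((P : ℂ) ^ 3 * fourierCoeff g k) := by
  rw [L2.inner_def, ← integral_mode_mul, ← integral_const_mul]
  refine integral_congr_ae ?_
  filter_upwards [coeFn_modeLp (P := P) k, (memLp_ofReal hg).coeFn_toLp] with x h1 h2
  rw [h1, h2, RCLike.inner_apply, map_mul, Complex.conj_ofReal, mode_neg]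
  ring

theorem inner_toLp_modeLp {g : Torus3 P → ℝ} (hg : MemLp g 2 volume) (k l : Fin 3 → ℤ) :
    inner ℂ (memLp_mode_mul hg k).toLp (modeLp P l) =
      (((√(P ^ 3))⁻¹ : ℝ) : ℂ) * ((P : ℂ) ^ 3 * fourierCoeff g (k - l)) := by
  rw [L2.inner_def, ← integral_mode_mul, ← integral_const_mul]
  refine integral_congr_ae ?_
  filter_upwards [coeFn_modeLp (P := P) l, (memLp_mode_mul hg k).coeFn_toLp] with x h1 h2
  rw [h1, h2, RCLike.inner_apply, map_mul, Complex.conj_ofReal, ← mode_neg, neg_sub,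
    sub_eq_add_neg, mode_add]
  ring

theorem inner_toLp_toLp {g h : Torus3 P → ℝ} (hg : MemLp g 2 volume) (hh : MemLp h 2 volume)
    (k : Fin 3 → ℤ) :
    inner ℂ (memLp_mode_mul hg k).toLp (memLp_ofReal hh).toLp =
      (P : ℂ) ^ 3 * fourierCoeff (fun x => h x * g x) k := by
  rw [L2.inner_def, ← integral_mode_mul]
  refine integral_congr_ae ?_
  filter_upwards [(memLp_mode_mul hg k).coeFn_toLp, (memLp_ofReal hh).coeFn_toLp] with x h1 h2
  rw [h1, h2, RCLike.inner_apply, map_mul, Complex.conj_ofReal, mode_neg]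
  push_cast
  ring

/-- The Fourier coefficients of a product of `L²` functions are given by a convolution. -/
theorem enorm_fourierCoeff_mul_le {g h : Torus3 P → ℝ} (hg : MemLp g 2 volume)
    (hh : MemLp h 2 volume) (k : Fin 3 → ℤ) :
    ‖fourierCoeff (fun x => h x * g x) k‖ₑ ≤
      ∑' l, ‖fourierCoeff h l‖ₑ * ‖fourierCoeff g (k - l)‖ₑ := by
  have hsum := (modeBasis P).hasSum_inner_mul_inner (memLp_mode_mul hg k).toLp
    (memLp_ofReal hh).toLp
  simp only [coe_modeBasis, inner_toLp_modeLp hg, inner_modeLp_toLp hh,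
    inner_toLp_toLp hg hh] at hsum
  have hP3 : (P : ℂ) ^ 3 ≠ 0 := pow_ne_zero 3 (by exact_mod_cast hP.out.ne')
  have hc : (((√(P ^ 3))⁻¹ : ℝ) : ℂ) * (((√(P ^ 3))⁻¹ : ℝ) : ℂ) * (P : ℂ) ^ 3 = 1 := by
    exact_mod_cast sqrt_cube_inv_sq (P := P)
  have hsum' := hsum.mul_left ((P : ℂ) ^ 3)⁻¹
  rw [← mul_assoc, inv_mul_cancel₀ hP3, one_mul] at hsum'
  have e : ∀ l, ((P : ℂ) ^ 3)⁻¹ * ((((√(P ^ 3))⁻¹ : ℝ) : ℂ) *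
      ((P : ℂ) ^ 3 * fourierCoeff g (k - l)) *
      ((((√(P ^ 3))⁻¹ : ℝ) : ℂ) * ((P : ℂ) ^ 3 * fourierCoeff h l))) =
      fourierCoeff h l * fourierCoeff g (k - l) := fun l => by
    calc _ = ((((√(P ^ 3))⁻¹ : ℝ) : ℂ) * (((√(P ^ 3))⁻¹ : ℝ) : ℂ) * (P : ℂ) ^ 3) *
          (((P : ℂ) ^ 3)⁻¹ * (P : ℂ) ^ 3) * (fourierCoeff h l * fourierCoeff g (k - l)) := by ring
      _ = _ := by rw [hc, inv_mul_cancel₀ hP3, one_mul, one_mul]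
  simp only [e] at hsum'
  rw [← hsum'.tsum_eq]
  refine enorm_tsum_le_tsum_enorm.trans_eq ?_
  simp only [enorm_mul]

/-- Bessel's inequality. -/
theorem tsum_enorm_fourierCoeff_sq_le {g : Torus3 P → ℝ} (hg : MemLp g 2 volume) :
    ENNReal.ofReal (P ^ 3) * ∑' k, ‖fourierCoeff g k‖ₑ ^ 2 ≤ ∫⁻ x, ‖g x‖ₑ ^ 2 := by
  have hle := (orthonormal_modeLp (P := P)).tsum_inner_products_le (memLp_ofReal hg).toLp
  have hsm := (orthonormal_modeLp (P := P)).inner_products_summable (memLp_ofReal hg).toLp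
  have hP3 : (0 : ℝ) < P ^ 3 := pow_pos hP.out 3
  have e : ∀ k, ‖inner ℂ (modeLp P k) (memLp_ofReal hg).toLp‖ ^ 2 =
      P ^ 3 * ‖fourierCoeff g k‖ ^ 2 := fun k => by
    rw [inner_modeLp_toLp hg, norm_mul, norm_mul, norm_pow, Complex.norm_real, Complex.norm_real,
      Real.norm_of_nonneg hP.out.le, Real.norm_of_nonneg (by positivity)]
    calc ((√(P ^ 3))⁻¹ * (P ^ 3 * ‖fourierCoeff g k‖)) ^ 2
        = ((√(P ^ 3))⁻¹ * (√(P ^ 3))⁻¹ * P ^ 3) * (P ^ 3 * ‖fourierCoeff g k‖ ^ 2) := by ring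
      _ = _ := by rw [sqrt_cube_inv_sq, one_mul]
  simp only [e] at hle hsm
  have h1 : ENNReal.ofReal (P ^ 3) * ∑' k, ‖fourierCoeff g k‖ₑ ^ 2 =
      ENNReal.ofReal (∑' k, P ^ 3 * ‖fourierCoeff g k‖ ^ 2) := by
    rw [ENNReal.ofReal_tsum_of_nonneg (fun k => by positivity) hsm, ← ENNReal.tsum_mul_left]
    refine tsum_congr fun k => ?_
    rw [ENNReal.ofReal_mul hP3.le, ENNReal.ofReal_pow (norm_nonneg _), ofReal_norm]
  have h2 : ENNReal.ofReal (‖(memLp_ofReal hg).toLp‖ ^ 2) = ∫⁻ x, ‖g x‖ₑ ^ 2 := by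
    rw [ENNReal.ofReal_pow (norm_nonneg _), ofReal_norm, Lp.enorm_toLp,
      eLpNorm_eq_lintegral_rpow_enorm_toReal (by simp) (by simp), ← ENNReal.rpow_natCast,
      ← ENNReal.rpow_mul]
    norm_num
    refine lintegral_congr fun x => ?_
    simp [enorm_eq_nnnorm]
  rw [h1, ← h2]
  exact ENNReal.ofReal_le_ofReal hle

omit hP in
theorem waveVec_sub (k l : Fin 3 → ℤ) (j : Fin 3) :
    waveVec P (k - l) j = waveVec P k j - waveVec P l j := by
  simp only [waveVec, Pi.sub_apply]
  push_cast
  ring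

/-- The weight `1 + |2πk/P|²` of the Sobolev norms. -/
noncomputable def sobolevWeight (P : ℝ) (k : Fin 3 → ℤ) : ℝ≥0∞ := ENNReal.ofReal (1 + waveSq P k)

/-- The bound on `∑_k |k|⁻⁴` comes from the lattice `ℤ³ ⊂ ℝ³` with the supremum norm. -/
theorem tsum_inv_sobolevWeight_sq_ne_top : ∑' k, (sobolevWeight P k)⁻¹ ^ 2 ≠ ⊤ := by
  classical
  set b := Pi.basisFun ℝ (Fin 3)
  set L : Submodule ℤ (Fin 3 → ℝ) := Submodule.span ℤ (range b)
  have hrank : Module.finrank ℤ L = 3 := by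
    rw [ZLattice.rank ℝ L]
    simp
  have hsum := ZLattice.summable_norm_pow_inv L 4 (by omega)
  let e : (Fin 3 → ℤ) → L := fun k => ⟨fun j => (k j : ℝ), by
    have : (fun j => (k j : ℝ)) = ∑ j, k j • b j := by
      ext i
      simp [b, Finset.sum_apply, Pi.single_apply]
    rw [this]
    exact Submodule.sum_mem _ fun j _ => Submodule.smul_mem _ _ (Submodule.subset_span ⟨j, rfl⟩)⟩
  have he : Function.Injective e := fun k l h => funext fun j => by
    have : (k j : ℝ) = l j := congrFun (congrArg Subtype.val h) j
    exact_mod_cast this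
  have hsum' : Summable fun k => ‖e k‖⁻¹ ^ 4 := hsum.comp_injective he
  have hP0 := hP.out
  set a : ℝ := 2 * Real.pi / P with ha
  have ha0 : 0 < a := by positivity
  have hle : ∀ k, ((1 + waveSq P k)⁻¹) ^ 2 ≤ (a⁻¹) ^ 4 * ‖e k‖⁻¹ ^ 4 + if k = 0 then 1 else 0 := by
    intro k
    have hw := waveSq_nonneg (P := P) k
    rcases eq_or_ne k 0 with rfl | hk
    · rw [if_pos rfl]
      refine le_add_of_nonneg_of_le (by positivity) ?_
      exact pow_le_one₀ (by positivity) (inv_le_one_of_one_le₀ (by linarith))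
    · rw [if_neg hk, add_zero]
      have hn : 0 < ‖e k‖ := norm_pos_iff.2 fun h => hk (he (h.trans (by ext; simp [e])))
      have hn2 : (a * ‖e k‖) ^ 2 ≤ waveSq P k := by
        have h1 : a * ‖e k‖ ≤ √(waveSq P k) := by
          rw [← le_div_iff₀' ha0]
          change ‖fun j => (k j : ℝ)‖ ≤ _
          refine (pi_norm_le_iff_of_nonneg (by positivity)).2 fun j => ?_
          rw [le_div_iff₀' ha0, Real.norm_eq_abs]
          refine le_trans (le_of_eq ?_) (abs_waveVec_le k j)
          have hv : waveVec P k j = a * k j := by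
            rw [ha, waveVec]
            ring
          rw [hv, abs_mul, abs_of_pos ha0]
        calc (a * ‖e k‖) ^ 2 ≤ √(waveSq P k) ^ 2 := by gcongr
          _ = _ := Real.sq_sqrt hw
      calc ((1 + waveSq P k)⁻¹) ^ 2 ≤ (((a * ‖e k‖) ^ 2)⁻¹) ^ 2 := by
            gcongr
            linarith
        _ = _ := by
            rw [mul_pow, mul_inv]
            ring
  have hsm : Summable fun k => ((1 + waveSq P k)⁻¹) ^ 2 := by
    refine Summable.of_nonneg_of_le (fun k => by positivity) hle ((hsum'.mul_left _).add ?_)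
    exact summable_of_hasFiniteSupport ((Set.finite_singleton (0 : Fin 3 → ℤ)).subset fun k hk => by
      by_contra h
      exact hk (if_neg h))
  have e2 : ∀ k, (sobolevWeight P k)⁻¹ ^ 2 = ENNReal.ofReal (((1 + waveSq P k)⁻¹) ^ 2) := by
    intro k
    have hw := waveSq_nonneg (P := P) k
    rw [sobolevWeight, ENNReal.ofReal_pow (by positivity),
      ENNReal.ofReal_inv_of_pos (by positivity)]
  simp only [e2]
  exact hsm.tsum_ofReal_ne_top

theorem isFrequencyWeight_sobolevWeight : MLAlpha.IsFrequencyWeight (sobolevWeight P) where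
  one_le k := by
    rw [sobolevWeight, ENNReal.one_le_ofReal]
    linarith [waveSq_nonneg (P := P) k]
  ne_top k := ENNReal.ofReal_ne_top
  neg k := by simp [sobolevWeight, waveSq, neg_div]
  le_add k l := by
    have h : waveSq P k ≤ 2 * (waveSq P l + waveSq P (k - l)) := by
      simp only [waveSq_eq_sum, ← Finset.sum_add_distrib, Finset.mul_sum]
      refine Finset.sum_le_sum fun j _ => ?_
      rw [waveVec_sub]
      nlinarith [sq_nonneg (waveVec P k j - 2 * waveVec P l j)]
    have h1 := waveSq_nonneg (P := P) l
    have h2 := waveSq_nonneg (P := P) (k - l)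
    rw [sobolevWeight, sobolevWeight, sobolevWeight,
      ← ENNReal.ofReal_add (by linarith) (by linarith),
      ← ENNReal.ofReal_ofNat, ← ENNReal.ofReal_mul (by norm_num)]
    exact ENNReal.ofReal_le_ofReal (by linarith)
  tsum_ne_top := tsum_inv_sobolevWeight_sq_ne_top

end Torus3

namespace Torus3

open Set
open scoped ENNReal NNReal ComplexConjugate ContDiff

/-! ### Trigonometric test functions -/

variable {P : ℝ}

/-- The function `cos(2πk·x / P)`. -/
noncomputable def cosMode (P : ℝ) (k : Fin 3 → ℤ) (x : Torus3 P) : ℝ := (mode P k x).re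

/-- The function `sin(2πk·x / P)`. -/
noncomputable def sinMode (P : ℝ) (k : Fin 3 → ℤ) (x : Torus3 P) : ℝ := (mode P k x).im

theorem cosMode_mk (k : Fin 3 → ℤ) (y : Fin 3 → ℝ) :
    cosMode P k (mk P y) = Real.cos (∑ j, waveVec P k j * y j) := by
  rw [cosMode, mode_mk, Complex.exp_ofReal_mul_I_re]

theorem sinMode_mk (k : Fin 3 → ℤ) (y : Fin 3 → ℝ) :
    sinMode P k (mk P y) = Real.sin (∑ j, waveVec P k j * y j) := by
  rw [sinMode, mode_mk, Complex.exp_ofReal_mul_I_im]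

theorem isSmooth_cosMode (k : Fin 3 → ℤ) : IsSmooth (cosMode P k) := by
  simp only [IsSmooth, cosMode_mk]
  fun_prop

theorem isSmooth_sinMode (k : Fin 3 → ℤ) : IsSmooth (sinMode P k) := by
  simp only [IsSmooth, sinMode_mk]
  fun_prop

theorem mk_add_mk_single (y : Fin 3 → ℝ) (j : Fin 3) (s : ℝ) :
    mk P y + mk P (Pi.single j s) = mk P (y + Pi.single j s) := by
  funext i
  simp [mk]

theorem sum_waveVec_mul_add_single (k : Fin 3 → ℤ) (y : Fin 3 → ℝ) (j : Fin 3) (s : ℝ) :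
    ∑ i, waveVec P k i * (y + Pi.single j s : Fin 3 → ℝ) i =
      (∑ i, waveVec P k i * y i) + waveVec P k j * s := by
  simp only [Pi.add_apply, mul_add, Finset.sum_add_distrib]
  congr 1
  rw [Finset.sum_eq_single j]
  · rw [Pi.single_eq_same]
  · intro i _ hi
    rw [Pi.single_eq_of_ne hi, mul_zero]
  · simp

theorem pderiv_cosMode (k : Fin 3 → ℤ) (j : Fin 3) (x : Torus3 P) :
    pderiv j (cosMode P k) x = -waveVec P k j * sinMode P k x := by
  obtain ⟨y, rfl⟩ := mk_surjective P x
  simp only [pderiv, mk_add_mk_single, cosMode_mk, sinMode_mk, sum_waveVec_mul_add_single]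
  have h : HasDerivAt (fun s : ℝ => (∑ i, waveVec P k i * y i) + waveVec P k j * s)
      (waveVec P k j) 0 := by
    simpa using ((hasDerivAt_id (0 : ℝ)).const_mul (waveVec P k j)).const_add
      (∑ i, waveVec P k i * y i)
  rw [h.cos.deriv]
  simp only [mul_zero, add_zero]
  ring

theorem pderiv_sinMode (k : Fin 3 → ℤ) (j : Fin 3) (x : Torus3 P) :
    pderiv j (sinMode P k) x = waveVec P k j * cosMode P k x := by
  obtain ⟨y, rfl⟩ := mk_surjective P x
  simp only [pderiv, mk_add_mk_single, cosMode_mk, sinMode_mk, sum_waveVec_mul_add_single]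
  have h : HasDerivAt (fun s : ℝ => (∑ i, waveVec P k i * y i) + waveVec P k j * s)
      (waveVec P k j) 0 := by
    simpa using ((hasDerivAt_id (0 : ℝ)).const_mul (waveVec P k j)).const_add
      (∑ i, waveVec P k i * y i)
  rw [h.sin.deriv]
  simp only [mul_zero, add_zero]
  ring

theorem pderiv_const_mul (a : ℝ) (ψ : Torus3 P → ℝ) (j : Fin 3) (x : Torus3 P) :
    pderiv j (fun x => a * ψ x) x = a * pderiv j ψ x := by
  simp only [pderiv]
  exact deriv_const_mul_field a

theorem laplacian_const_mul (a : ℝ) (ψ : Torus3 P → ℝ) (x : Torus3 P) :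
    laplacian (fun x => a * ψ x) x = a * laplacian ψ x := by
  have h : ∀ j, pderiv j (fun x => a * ψ x) = fun x => a * pderiv j ψ x := fun j =>
    funext fun x => pderiv_const_mul a ψ j x
  simp only [laplacian, h, pderiv_const_mul, Finset.mul_sum]

theorem laplacian_cosMode (k : Fin 3 → ℤ) (x : Torus3 P) :
    laplacian (cosMode P k) x = -waveSq P k * cosMode P k x := by
  have h : ∀ j, pderiv j (cosMode P k) = fun x => -waveVec P k j * sinMode P k x := fun j =>
    funext fun x => pderiv_cosMode k j x
  simp only [laplacian, h, pderiv_const_mul, pderiv_sinMode, waveSq_eq_sum,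
    ← Finset.sum_neg_distrib,
    Finset.sum_mul]
  exact Finset.sum_congr rfl fun j _ => by ring

theorem laplacian_sinMode (k : Fin 3 → ℤ) (x : Torus3 P) :
    laplacian (sinMode P k) x = -waveSq P k * sinMode P k x := by
  have h : ∀ j, pderiv j (sinMode P k) = fun x => waveVec P k j * cosMode P k x := fun j =>
    funext fun x => pderiv_sinMode k j x
  simp only [laplacian, h, pderiv_const_mul, pderiv_cosMode, waveSq_eq_sum,
    ← Finset.sum_neg_distrib,
    Finset.sum_mul]
  exact Finset.sum_congr rfl fun j _ => by ring

variable [hP : Fact (0 < P)]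

theorem integrable_mode_mul {g : Torus3 P → ℝ} (hg : Integrable g) (k : Fin 3 → ℤ) :
    Integrable fun x => mode P k x * (g x : ℂ) :=
  hg.ofReal.bdd_mul (c := 1) (mode P k).continuous.aestronglyMeasurable
    (Filter.Eventually.of_forall fun x => (norm_mode_apply k x).le)

theorem integrable_mul_cosMode {g : Torus3 P → ℝ} (hg : Integrable g) (k : Fin 3 → ℤ) :
    Integrable fun x => g x * cosMode P k x := by
  convert (integrable_mode_mul hg k).re using 2 with x
  simp [cosMode, mul_comm]

theorem integrable_mul_sinMode {g : Torus3 P → ℝ} (hg : Integrable g) (k : Fin 3 → ℤ) :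
    Integrable fun x => g x * sinMode P k x := by
  convert (integrable_mode_mul hg k).im using 2 with x
  simp [sinMode, mul_comm]

theorem integral_mul_cosMode {g : Torus3 P → ℝ} (hg : Integrable g) (k : Fin 3 → ℤ) :
    ∫ x, g x * cosMode P k x = P ^ 3 * (fourierCoeff g k).re := by
  have h := congrArg Complex.re (integral_mode_mul g k)
  rw [← Complex.ofReal_pow, Complex.re_ofReal_mul] at h
  rw [← h, ← Complex.reCLM_apply, ← Complex.reCLM.integral_comp_comm (integrable_mode_mul hg _)]
  refine integral_congr_ae (Filter.Eventually.of_forall fun x => ?_)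
  simp [cosMode, mode_neg, mul_comm]

theorem integral_mul_sinMode {g : Torus3 P → ℝ} (hg : Integrable g) (k : Fin 3 → ℤ) :
    ∫ x, g x * sinMode P k x = -(P ^ 3 * (fourierCoeff g k).im) := by
  have h := congrArg Complex.im (integral_mode_mul g k)
  rw [← Complex.ofReal_pow, Complex.im_ofReal_mul] at h
  rw [← h, ← Complex.imCLM_apply, ← Complex.imCLM.integral_comp_comm (integrable_mode_mul hg _),
    ← integral_neg]
  refine integral_congr_ae (Filter.Eventually.of_forall fun x => ?_)
  simp [sinMode, mode_neg, mul_comm]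

/-! ### The stationary equations on the Fourier side -/

theorem sum_waveVec_mul_fourierCoeff_eq_zero {u : Fin 3 → Torus3 P → ℝ}
    (hu : ∀ i, Integrable (u i))
    (hdiv : ∀ ψ : Torus3 P → ℝ, IsSmooth ψ → (∫ x, ∑ j, u j x * pderiv j ψ x) = 0)
    (k : Fin 3 → ℤ) : ∑ j, (waveVec P k j : ℂ) * fourierCoeff (u j) k = 0 := by
  have hP3 : P ^ 3 ≠ 0 := pow_ne_zero 3 hP.out.ne'
  apply Complex.ext
  · have h := hdiv _ (isSmooth_sinMode k)
    simp only [pderiv_sinMode, mul_left_comm (u _ _)] at h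
    rw [integral_finsetSum _ fun j _ => (integrable_mul_cosMode (hu j) k).const_mul _] at h
    simp only [integral_const_mul, integral_mul_cosMode (hu _), mul_left_comm _ (P ^ 3),
      ← Finset.mul_sum, mul_eq_zero, hP3, false_or] at h
    simpa using h
  · have h := hdiv _ (isSmooth_cosMode k)
    simp only [pderiv_cosMode, mul_left_comm (u _ _)] at h
    rw [integral_finsetSum _ fun j _ => (integrable_mul_sinMode (hu j) k).const_mul _] at h
    simp only [integral_const_mul, integral_mul_sinMode (hu _), neg_mul_neg,
      mul_left_comm _ (P ^ 3), ← Finset.mul_sum, mul_eq_zero, hP3, false_or] at h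
    simpa using h

/-- The `i`-th component of `-α²Δb + b + ∇π = u`, tested with the real and imaginary parts of the
exponentials. -/
theorem filter_fourierCoeff {α : ℝ} {b u π : Torus3 P → ℝ} {i : Fin 3} (hb : Integrable b)
    (hu : Integrable u) (hπ : Integrable π)
    (h : ∀ ψ : Torus3 P → ℝ, IsSmooth ψ →
      (∫ x, (-(α ^ 2 * (b x * laplacian ψ x)) + b x * ψ x - π x * pderiv i ψ x)) =
        ∫ x, u x * ψ x) (k : Fin 3 → ℤ) :
    ((1 + α ^ 2 * waveSq P k : ℝ) : ℂ) * fourierCoeff b k +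
      Complex.I * ((waveVec P k i : ℂ) * fourierCoeff π k) = fourierCoeff u k := by
  have hP3 : P ^ 3 ≠ 0 := pow_ne_zero 3 hP.out.ne'
  apply Complex.ext
  · have hc := h _ (isSmooth_cosMode k)
    have e : ∀ x, -(α ^ 2 * (b x * laplacian (cosMode P k) x)) + b x * cosMode P k x -
        π x * pderiv i (cosMode P k) x = (1 + α ^ 2 * waveSq P k) * (b x * cosMode P k x) +
          waveVec P k i * (π x * sinMode P k x) := fun x => by
      rw [laplacian_cosMode, pderiv_cosMode]
      ring
    simp only [e] at hc
    rw [integral_add ((integrable_mul_cosMode hb k).const_mul _)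
      ((integrable_mul_sinMode hπ k).const_mul _), integral_const_mul, integral_const_mul,
      integral_mul_cosMode hb, integral_mul_sinMode hπ, integral_mul_cosMode hu] at hc
    apply mul_left_cancel₀ hP3
    rw [← hc, Complex.add_re, Complex.re_ofReal_mul, Complex.I_mul_re, Complex.im_ofReal_mul]
    ring
  · have hc := h _ (isSmooth_sinMode k)
    have e : ∀ x, -(α ^ 2 * (b x * laplacian (sinMode P k) x)) + b x * sinMode P k x -
        π x * pderiv i (sinMode P k) x = (1 + α ^ 2 * waveSq P k) * (b x * sinMode P k x) +
          -waveVec P k i * (π x * cosMode P k x) := fun x => by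
      rw [laplacian_sinMode, pderiv_sinMode]
      ring
    simp only [e] at hc
    rw [integral_add ((integrable_mul_sinMode hb k).const_mul _)
      ((integrable_mul_cosMode hπ k).const_mul _), integral_const_mul, integral_const_mul,
      integral_mul_sinMode hb, integral_mul_cosMode hπ, integral_mul_sinMode hu] at hc
    apply mul_left_cancel₀ hP3
    rw [← neg_inj, ← hc, Complex.add_im, Complex.im_ofReal_mul, Complex.I_mul_im,
      Complex.re_ofReal_mul]
    ring

/-- The filter equation says `ubar^(k) = u^(k) / (1 + α²|2πk/P|²)`: its gradient term vanishes,
since both fields are divergence free. -/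
theorem fourierCoeff_filtered {α : ℝ} {b u : Fin 3 → Torus3 P → ℝ} {π : Torus3 P → ℝ}
    (hb : ∀ i, Integrable (b i)) (hu : ∀ i, Integrable (u i)) (hπ : Integrable π)
    (h : ∀ i, ∀ ψ : Torus3 P → ℝ, IsSmooth ψ →
      (∫ x, (-(α ^ 2 * (b i x * laplacian ψ x)) + b i x * ψ x - π x * pderiv i ψ x)) =
        ∫ x, u i x * ψ x)
    (hdivu : ∀ ψ : Torus3 P → ℝ, IsSmooth ψ → (∫ x, ∑ j, u j x * pderiv j ψ x) = 0)
    (hdivb : ∀ ψ : Torus3 P → ℝ, IsSmooth ψ → (∫ x, ∑ j, b j x * pderiv j ψ x) = 0)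
    (i : Fin 3) (k : Fin 3 → ℤ) :
    ((1 + α ^ 2 * waveSq P k : ℝ) : ℂ) * fourierCoeff (b i) k = fourierCoeff (u i) k := by
  have hF := fun i => filter_fourierCoeff (hb i) (hu i) hπ (h i) k
  have hu0 := sum_waveVec_mul_fourierCoeff_eq_zero hu hdivu k
  have hb0 := sum_waveVec_mul_fourierCoeff_eq_zero hb hdivb k
  have hw : (waveSq P k : ℂ) * fourierCoeff π k = 0 := by
    have e : ∑ i, (waveVec P k i : ℂ) * (((1 + α ^ 2 * waveSq P k : ℝ) : ℂ) * fourierCoeff (b i) k +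
        Complex.I * ((waveVec P k i : ℂ) * fourierCoeff π k)) = 0 := by
      simp only [hF, hu0]
    have e' : ∑ i, (waveVec P k i : ℂ) *
        (((1 + α ^ 2 * waveSq P k : ℝ) : ℂ) * fourierCoeff (b i) k +
        Complex.I * ((waveVec P k i : ℂ) * fourierCoeff π k)) =
        ((1 + α ^ 2 * waveSq P k : ℝ) : ℂ) * ∑ i, (waveVec P k i : ℂ) * fourierCoeff (b i) k +
        Complex.I * ((waveSq P k : ℂ) * fourierCoeff π k) := by
      rw [waveSq_eq_sum]
      push_cast
      simp only [Fin.sum_univ_three]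
      ring
    rw [e', hb0, mul_zero, zero_add] at e
    exact (mul_eq_zero.1 e).resolve_left Complex.I_ne_zero
  have hz : (waveVec P k i : ℂ) * fourierCoeff π k = 0 := by
    rcases mul_eq_zero.1 hw with h0 | h0
    · have h0' : waveSq P k = 0 := by exact_mod_cast h0
      have : waveVec P k i = 0 := by
        have := abs_waveVec_le (P := P) k i
        rw [h0', Real.sqrt_zero] at this
        exact abs_nonpos_iff.1 this
      simp [this]
    · simp [h0]
  rw [← hF i, hz, mul_zero, add_zero]

omit hP in
theorem one_add_waveSq_le {α : ℝ} (hα : 0 < α) (k : Fin 3 → ℤ) :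
    1 + waveSq P k ≤ (1 + (α ^ 2)⁻¹) * (1 + α ^ 2 * waveSq P k) := by
  have hw := waveSq_nonneg (P := P) k
  have hα2 : 0 < α ^ 2 := by positivity
  have : (1 + (α ^ 2)⁻¹) * (1 + α ^ 2 * waveSq P k) =
      1 + waveSq P k + ((α ^ 2)⁻¹ + α ^ 2 * waveSq P k) := by
    field_simp
    ring
  rw [this]
  exact le_add_of_nonneg_right (by positivity)

omit hP in
/-- Inverting `1 + α² |2πk/P|²` gains two derivatives. -/
theorem enorm_le_of_mul_eq {α : ℝ} (hα : 0 < α) (k : Fin 3 → ℤ) {z w : ℂ}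
    (h : ((1 + α ^ 2 * waveSq P k : ℝ) : ℂ) * z = w) :
    ‖z‖ₑ ≤ ENNReal.ofReal (1 + (α ^ 2)⁻¹) * (‖w‖ₑ * (sobolevWeight P k)⁻¹) := by
  have hw := waveSq_nonneg (P := P) k
  have hJ : 0 < 1 + waveSq P k := by linarith
  have key : ‖z‖ ≤ (1 + (α ^ 2)⁻¹) * (‖w‖ * (1 + waveSq P k)⁻¹) := by
    rw [← h, norm_mul, Complex.norm_real, Real.norm_of_nonneg (by positivity), ← mul_assoc,
      ← div_eq_mul_inv, le_div_iff₀ hJ, mul_comm, ← mul_assoc]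
    exact mul_le_mul_of_nonneg_right (one_add_waveSq_le hα k) (norm_nonneg _)
  rw [sobolevWeight, ← ENNReal.ofReal_inv_of_pos hJ, ← ofReal_norm, ← ofReal_norm,
    ← ENNReal.ofReal_mul (norm_nonneg _), ← ENNReal.ofReal_mul (by positivity)]
  exact ENNReal.ofReal_le_ofReal key

end Torus3

namespace MLAlpha

open Set
open scoped ENNReal NNReal ContDiff

/-! ### Weak solutions of linear ordinary differential equations -/

/-- A `C^∞` function of time vanishing from some time `S < T` on. -/
def IsTimeTest (T : ℝ) (θ : ℝ → ℝ) : Prop :=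
  ContDiff ℝ ∞ θ ∧ ∃ S < T, ∀ t, S ≤ t → θ t = 0

theorem isTimeTest_of_tsupport_subset {T : ℝ} (hT : 0 < T) {ζ : ℝ → ℝ} (hζ : ContDiff ℝ ∞ ζ)
    (hc : HasCompactSupport ζ) (hs : tsupport ζ ⊆ Ioo 0 T) : IsTimeTest T ζ := by
  refine ⟨hζ, ?_⟩
  rcases (tsupport ζ).eq_empty_or_nonempty with h | h
  · exact ⟨0, hT, fun t _ => image_eq_zero_of_notMem_tsupport (by simp [h])⟩
  · obtain ⟨S, hS, hmax⟩ := hc.isCompact.exists_isGreatest h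
    have hST := (hs hS).2
    refine ⟨(S + T) / 2, by linarith, fun t ht => image_eq_zero_of_notMem_tsupport fun hmem => ?_⟩
    have := hmax hmem
    linarith

/-- A weakly vanishing integrable function vanishes. -/
theorem ae_eq_zero_of_forall_integral {T : ℝ} {g : ℝ → ℂ} (hg : IntegrableOn g (Ioo 0 T))
    (h : ∀ ζ : ℝ → ℝ, ContDiff ℝ ∞ ζ → HasCompactSupport ζ → tsupport ζ ⊆ Ioo 0 T →
      ∫ t in Ioo 0 T, ζ t • g t = 0) :
    ∀ᵐ t ∂volume.restrict (Ioo 0 T), g t = 0 := by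
  rw [ae_restrict_iff' measurableSet_Ioo]
  refine isOpen_Ioo.ae_eq_zero_of_integral_contDiff_smul_eq_zero hg.locallyIntegrableOn
    fun ζ h1 h2 h3 => ?_
  rw [← h ζ h1 h2 h3, setIntegral_eq_integral_of_forall_compl_eq_zero]
  intro t ht
  rw [image_eq_zero_of_notMem_tsupport fun hmem => ht (h3 hmem), zero_smul]

theorem hasDerivAt_primitive {ζ : ℝ → ℝ} (hζ : Continuous ζ) (T t : ℝ) :
    HasDerivAt (fun t => ∫ s in T..t, ζ s) (ζ t) t :=
  intervalIntegral.integral_hasDerivAt_right (hζ.intervalIntegrable _ _)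
    (hζ.stronglyMeasurableAtFilter _ _) hζ.continuousAt

theorem contDiff_primitive {ζ : ℝ → ℝ} (hζ : ContDiff ℝ ∞ ζ) (T : ℝ) :
    ContDiff ℝ ∞ fun t => ∫ s in T..t, ζ s := by
  have hd := fun t => hasDerivAt_primitive hζ.continuous T t
  rw [contDiff_infty_iff_deriv]
  refine ⟨fun t => (hd t).differentiableAt, ?_⟩
  have : deriv (fun t => ∫ s in T..t, ζ s) = ζ := funext fun t => (hd t).deriv
  rwa [this]

theorem integrableOn_continuous_smul {T : ℝ} {ζ : ℝ → ℝ} (hζ : Continuous ζ) {w : ℝ → ℂ}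
    (hw : IntegrableOn w (Ioo 0 T)) : IntegrableOn (fun t => ζ t • w t) (Ioo 0 T) := by
  obtain ⟨M, hM⟩ := (isCompact_Icc (a := (0 : ℝ)) (b := T)).exists_bound_of_continuousOn
    hζ.continuousOn
  refine Integrable.bdd_smul hw M hζ.aestronglyMeasurable ?_
  filter_upwards [ae_restrict_mem measurableSet_Ioo] with t ht
  exact hM t ⟨ht.1.le, ht.2.le⟩

/-- An integrable weak solution of `v' = -c v + g`, `v(0) = v₀`, is given by Duhamel's formula. The
equation is tested with `e^{ct} η(t)`, where `η` is a primitive of a given bump function. -/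
theorem ae_eq_duhamel {T c : ℝ} (hT : 0 < T) {v g : ℝ → ℂ} {v₀ : ℂ}
    (hv : IntegrableOn v (Ioo 0 T)) (hg : IntegrableOn g (Ioo 0 T))
    (h : ∀ θ : ℝ → ℝ, IsTimeTest T θ →
      ∫ t in Ioo 0 T, (-(deriv θ t • v t) + θ t • ((c : ℂ) * v t - g t)) = θ 0 • v₀) :
    ∀ᵐ t ∂volume.restrict (Ioo 0 T), v t = Real.exp (-c * t) • v₀ +
      ∫ s in Ioo 0 T, (Iio t).indicator (fun s => Real.exp (-c * (t - s)) • g s) s := by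
  set μ := volume.restrict (Ioo 0 T) with hμ
  have hexp : ∀ a : ℝ, Continuous fun t => Real.exp (a * t) := fun a => by fun_prop
  have hbdd : ∀ (ζ : ℝ → ℝ), Continuous ζ → ∀ {w : ℝ → ℂ}, Integrable w μ →
      Integrable (fun t => ζ t • w t) μ := fun ζ hζ _ hw => integrableOn_continuous_smul hζ hw
  set g' : ℝ → ℂ := fun s => Real.exp (c * s) • g s with hg'
  have hg'i : Integrable g' μ := hbdd _ (hexp c) hg
  set G : ℝ → ℂ := fun t => ∫ s, (Iio t).indicator g' s ∂μ with hG
  have htri : MeasurableSet {z : ℝ × ℝ | z.2 < z.1} :=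
    measurableSet_lt measurable_snd measurable_fst
  have hprod : ∀ ζ : ℝ → ℝ, Integrable ζ μ → Integrable (fun z : ℝ × ℝ =>
      {z : ℝ × ℝ | z.2 < z.1}.indicator (fun z => ζ z.1 • g' z.2) z) (μ.prod μ) := fun ζ hζ =>
    (hζ.smul_prod hg'i).indicator htri
  have hind : ∀ (ζ : ℝ → ℝ) (t s : ℝ), {z : ℝ × ℝ | z.2 < z.1}.indicator
      (fun z => ζ z.1 • g' z.2) (t, s) = ζ t • (Iio t).indicator g' s := by
    intro ζ t s
    by_cases hst : s < t
    · rw [indicator_of_mem (by exact hst), indicator_of_mem (by exact hst)]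
    · rw [indicator_of_notMem (by exact hst), indicator_of_notMem (by exact hst), smul_zero]
  have hGi : Integrable G μ := by
    have h1 := (hprod (fun _ => 1) (integrable_const 1)).integral_prod_left
    refine h1.congr (Filter.Eventually.of_forall fun t => ?_)
    exact integral_congr_ae (Filter.Eventually.of_forall fun s =>
      (hind (fun _ => 1) t s).trans (one_smul _ _))
  have hzero : ∀ᵐ t ∂μ, Real.exp (c * t) • v t - v₀ - G t = 0 := by
    refine ae_eq_zero_of_forall_integral
      (((hbdd _ (hexp c) hv).sub (integrable_const v₀)).sub hGi) fun ζ h1 h2 h3 => ?_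
    have hζi : Integrable ζ μ := (h1.continuous.integrable_of_hasCompactSupport h2).restrict
    obtain ⟨-, S, hST, hS⟩ := isTimeTest_of_tsupport_subset hT h1 h2 h3
    set η : ℝ → ℝ := fun t => ∫ s in T..t, ζ s with hη
    have hθ : IsTimeTest T fun t => Real.exp (c * t) * η t := by
      refine ⟨(by fun_prop : ContDiff ℝ ∞ fun t => Real.exp (c * t)).mul (contDiff_primitive h1 T),
        S, hST, fun t ht => ?_⟩
      have : η t = 0 := by
        rw [hη]
        refine (intervalIntegral.integral_congr (g := fun _ => 0)
          fun s hs => hS s ?_).trans (by simp)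
        rcases le_total T t with hTt | hTt
        · rw [uIcc_of_le hTt] at hs
          linarith [hs.1]
        · rw [uIcc_of_ge hTt] at hs
          linarith [hs.1]
      simp only [this, mul_zero]
    have hder : ∀ t, deriv (fun t => Real.exp (c * t) * η t) t =
        c * (Real.exp (c * t) * η t) + Real.exp (c * t) * ζ t := fun t => by
      have he : HasDerivAt (fun t => Real.exp (c * t)) (Real.exp (c * t) * c) t := by
        simpa using ((hasDerivAt_id t).const_mul c).exp
      refine (he.mul (hasDerivAt_primitive h1.continuous T t)).deriv.trans ?_
      simp only [hη]
      ring
    have hη0 : η 0 = -∫ t, ζ t ∂μ := by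
      rw [hη, hμ, ← integral_Ioc_eq_integral_Ioo, ← intervalIntegral.integral_of_le hT.le,
        intervalIntegral.integral_symm, neg_neg]
    have hηs : ∀ᵐ s ∂μ, η s = -∫ t, (Ioi s).indicator ζ t ∂μ := by
      filter_upwards [ae_restrict_mem measurableSet_Ioo] with s hs
      rw [integral_indicator measurableSet_Ioi, hμ, Measure.restrict_restrict measurableSet_Ioi]
      have : Ioi s ∩ Ioo 0 T = Ioo s T := by
        ext t
        simp only [mem_inter_iff, mem_Ioi, mem_Ioo]
        exact ⟨fun ⟨a, b⟩ => ⟨a, b.2⟩, fun ⟨a, b⟩ => ⟨a, hs.1.trans a, b⟩⟩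
      rw [this, ← integral_Ioc_eq_integral_Ioo, ← intervalIntegral.integral_of_le hs.2.le, hη,
        intervalIntegral.integral_symm, neg_neg]
    have hηc : Continuous η := (contDiff_primitive h1 T).continuous
    -- Fubini on the triangle `s < t`
    have hfub : ∫ s, η s • g' s ∂μ = -∫ t, ζ t • G t ∂μ := by
      have e1 : ∫ s, η s • g' s ∂μ = ∫ s, -∫ t, ζ t • (Iio t).indicator g' s ∂μ ∂μ := by
        refine integral_congr_ae ?_
        filter_upwards [hηs] with s hs
        rw [hs, neg_smul, ← integral_smul_const]
        congr 1
        refine integral_congr_ae (Filter.Eventually.of_forall fun t => ?_)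
        by_cases hst : s < t
        · simp only [indicator_of_mem (show t ∈ Ioi s from hst),
            indicator_of_mem (show s ∈ Iio t from hst)]
        · simp only [indicator_of_notMem (show t ∉ Ioi s from hst),
            indicator_of_notMem (show s ∉ Iio t from hst), zero_smul, smul_zero]
      have hsw := integral_integral_swap (μ := μ) (ν := μ)
        (f := fun t s => ζ t • (Iio t).indicator g' s)
        (by simpa only [Function.uncurry_def, ← hind] using hprod ζ hζi)
      rw [e1, integral_neg, ← hsw]
      simp only [integral_smul, hG]
    have hmain := h _ hθ
    have hvi : Integrable (fun t => ζ t • Real.exp (c * t) • v t) μ :=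
      hbdd ζ h1.continuous (hbdd _ (hexp c) hv)
    have hvin : Integrable (fun t => -(ζ t • Real.exp (c * t) • v t)) μ := hvi.neg
    have hζ0 : Integrable (fun t => ζ t • v₀) μ := hζi.smul_const v₀
    have hvs : Integrable (fun t => ζ t • Real.exp (c * t) • v t - ζ t • v₀) μ := hvi.sub hζ0
    have hgi : Integrable (fun t => η t • g' t) μ := hbdd η hηc hg'i
    have e2 : ∫ t, (-(deriv (fun t => Real.exp (c * t) * η t) t • v t) +
        (Real.exp (c * t) * η t) • ((c : ℂ) * v t - g t)) ∂μ =
        ∫ t, (-(ζ t • Real.exp (c * t) • v t) - η t • g' t) ∂μ := by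
      refine integral_congr_ae (Filter.Eventually.of_forall fun t => ?_)
      simp only [hder, hg', Complex.real_smul]
      push_cast
      ring
    rw [e2, integral_sub hvin hgi, integral_neg, hfub, mul_zero, Real.exp_zero, one_mul,
      hη0] at hmain
    simp only [smul_sub]
    rw [integral_sub hvs (hbdd ζ h1.continuous hGi),
      integral_sub hvi hζ0, integral_smul_const]
    rw [neg_smul] at hmain
    linear_combination -hmain
  filter_upwards [hzero] with t ht
  have hvt : v t = Real.exp (-c * t) • (v₀ + G t) := by
    have : Real.exp (c * t) • v t = v₀ + G t := by linear_combination ht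
    rw [← this, smul_smul, ← Real.exp_add]
    simp
  rw [hvt, smul_add, hG, ← integral_smul]
  congr 1
  refine integral_congr_ae (Filter.Eventually.of_forall fun s => ?_)
  by_cases hs : s ∈ Iio t
  · simp only [indicator_of_mem hs, hg', smul_smul, ← Real.exp_add]
    congr 2
    ring
  · simp only [indicator_of_notMem hs, smul_zero]

/-- The modulus of Duhamel's formula, in terms of the causal kernel `decay`. -/
theorem enorm_duhamel_le {T c : ℝ} {v₀ : ℂ} {g : ℝ → ℂ} {t : ℝ} (ht : 0 < t) :
    ‖Real.exp (-c * t) • v₀ +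
      ∫ s in Ioo 0 T, (Iio t).indicator (fun s => Real.exp (-c * (t - s)) • g s) s‖ₑ ≤
    decay c t * ‖v₀‖ₑ + ∫⁻ s in Ioo 0 T, decay c (t - s) * ‖g s‖ₑ := by
  refine (enorm_add_le _ _).trans (add_le_add ?_ ?_)
  · rw [decay_of_pos ht, enorm_smul, Real.enorm_of_nonneg (Real.exp_pos _).le]
  · refine (enorm_integral_le_lintegral_enorm _).trans (lintegral_mono fun s => ?_)
    by_cases hs : s < t
    · rw [indicator_of_mem (by exact hs), decay_of_pos (sub_pos.2 hs), enorm_smul,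
        Real.enorm_of_nonneg (Real.exp_pos _).le]
    · rw [indicator_of_notMem (by exact hs)]
      simp

end MLAlpha

namespace Torus3

open Set MLAlpha
open scoped ENNReal NNReal ComplexConjugate ContDiff

/-! ### The momentum equation on the Fourier side -/

variable {P : ℝ} [hP : Fact (0 < P)]

section Slice

variable {U q : Torus3 P → ℝ} {N : Fin 3 → Torus3 P → ℝ} (hU : Integrable U)
  (hN : ∀ j, Integrable (N j)) (hq : Integrable q) (ν a b : ℝ) (i : Fin 3) (k : Fin 3 → ℤ)

include hU hN hq

theorem integral_momentum_cosMode :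
    ∫ x, (-(U x * (a * cosMode P k x)) - (∑ j, N j x * pderiv j (fun x => b * cosMode P k x) x) -
      ν * (U x * laplacian (fun x => b * cosMode P k x) x) -
      q x * pderiv i (fun x => b * cosMode P k x) x) =
    P ^ 3 * (-(a • fourierCoeff U k) + b • (((ν * waveSq P k : ℝ) : ℂ) * fourierCoeff U k +
      Complex.I * (∑ j, (waveVec P k j : ℂ) * fourierCoeff (N j) k +
        (waveVec P k i : ℂ) * fourierCoeff q k))).re := by
  have e : ∀ x, (-(U x * (a * cosMode P k x)) -
      (∑ j, N j x * pderiv j (fun x => b * cosMode P k x) x) -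
      ν * (U x * laplacian (fun x => b * cosMode P k x) x) -
      q x * pderiv i (fun x => b * cosMode P k x) x) =
      (-a + b * (ν * waveSq P k)) * (U x * cosMode P k x) +
        ∑ j, (b * waveVec P k j) * (N j x * sinMode P k x) +
        (b * waveVec P k i) * (q x * sinMode P k x) := fun x => by
    simp only [pderiv_const_mul, laplacian_const_mul, pderiv_cosMode, laplacian_cosMode,
      Fin.sum_univ_three]
    ring
  have i1 := (integrable_mul_cosMode hU k).const_mul (-a + b * (ν * waveSq P k))
  have i2 := fun j => (integrable_mul_sinMode (hN j) k).const_mul (b * waveVec P k j)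
  have i3 := (integrable_mul_sinMode hq k).const_mul (b * waveVec P k i)
  have i4 := integrable_finsetSum Finset.univ fun j _ => i2 j
  have i5 : Integrable fun x => (-a + b * (ν * waveSq P k)) * (U x * cosMode P k x) +
      ∑ j, (b * waveVec P k j) * (N j x * sinMode P k x) := i1.add i4
  simp only [e]
  rw [integral_add i5 i3, integral_add i1 i4, integral_finsetSum _ fun j _ => i2 j]
  simp only [integral_const_mul, integral_mul_cosMode hU, integral_mul_sinMode hq,
    integral_mul_sinMode (hN _), Fin.sum_univ_three, Complex.add_re, Complex.neg_re,
    Complex.smul_re, smul_eq_mul, Complex.re_ofReal_mul, Complex.I_mul_re, Complex.add_im,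
    Complex.im_ofReal_mul]
  ring

theorem integral_momentum_sinMode :
    ∫ x, (-(U x * (a * sinMode P k x)) - (∑ j, N j x * pderiv j (fun x => b * sinMode P k x) x) -
      ν * (U x * laplacian (fun x => b * sinMode P k x) x) -
      q x * pderiv i (fun x => b * sinMode P k x) x) =
    -(P ^ 3 * (-(a • fourierCoeff U k) + b • (((ν * waveSq P k : ℝ) : ℂ) * fourierCoeff U k +
      Complex.I * (∑ j, (waveVec P k j : ℂ) * fourierCoeff (N j) k +
        (waveVec P k i : ℂ) * fourierCoeff q k))).im) := by
  have e : ∀ x, (-(U x * (a * sinMode P k x)) -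
      (∑ j, N j x * pderiv j (fun x => b * sinMode P k x) x) -
      ν * (U x * laplacian (fun x => b * sinMode P k x) x) -
      q x * pderiv i (fun x => b * sinMode P k x) x) =
      (-a + b * (ν * waveSq P k)) * (U x * sinMode P k x) +
        ∑ j, (-(b * waveVec P k j)) * (N j x * cosMode P k x) +
        (-(b * waveVec P k i)) * (q x * cosMode P k x) := fun x => by
    simp only [pderiv_const_mul, laplacian_const_mul, pderiv_sinMode, laplacian_sinMode,
      Fin.sum_univ_three]
    ring
  have i1 := (integrable_mul_sinMode hU k).const_mul (-a + b * (ν * waveSq P k))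
  have i2 := fun j => (integrable_mul_cosMode (hN j) k).const_mul (-(b * waveVec P k j))
  have i3 := (integrable_mul_cosMode hq k).const_mul (-(b * waveVec P k i))
  have i4 := integrable_finsetSum Finset.univ fun j _ => i2 j
  have i5 : Integrable fun x => (-a + b * (ν * waveSq P k)) * (U x * sinMode P k x) +
      ∑ j, (-(b * waveVec P k j)) * (N j x * cosMode P k x) := i1.add i4
  simp only [e]
  rw [integral_add i5 i3, integral_add i1 i4, integral_finsetSum _ fun j _ => i2 j]
  simp only [integral_const_mul, integral_mul_sinMode hU, integral_mul_cosMode hq,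
    integral_mul_cosMode (hN _), Fin.sum_univ_three, Complex.add_im, Complex.neg_im,
    Complex.smul_im, smul_eq_mul, Complex.im_ofReal_mul, Complex.I_mul_im, Complex.add_re,
    Complex.re_ofReal_mul]
  ring

end Slice

theorem integrable_fourierCoeff {μ : Measure ℝ} {v : ℝ → Torus3 P → ℝ}
    (hv : Integrable (Function.uncurry v) (μ.prod volume)) (k : Fin 3 → ℤ) :
    Integrable (fun t => fourierCoeff (v t) k) μ := by
  have h : Integrable (fun z : ℝ × Torus3 P => mode P (-k) z.2 * (v z.1 z.2 : ℂ))
      (μ.prod volume) := by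
    refine hv.ofReal.bdd_mul (c := 1)
      ((mode P (-k)).continuous.comp continuous_snd).aestronglyMeasurable ?_
    exact Filter.Eventually.of_forall fun z => (norm_mode_apply (-k) z.2).le
  exact h.integral_prod_left.const_mul _

omit hP in
theorem isTestFunction_mul_cosMode {T : ℝ} {θ : ℝ → ℝ} (hθ : IsTimeTest T θ) (k : Fin 3 → ℤ) :
    IsTestFunction T fun t x => θ t * cosMode P k x := by
  obtain ⟨h1, S, hS, h2⟩ := hθ
  refine ⟨?_, S, hS, fun t ht x => by simp only [h2 t ht, zero_mul]⟩
  exact (h1.comp contDiff_fst).mul ((isSmooth_cosMode k).comp contDiff_snd)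

omit hP in
theorem isTestFunction_mul_sinMode {T : ℝ} {θ : ℝ → ℝ} (hθ : IsTimeTest T θ) (k : Fin 3 → ℤ) :
    IsTestFunction T fun t x => θ t * sinMode P k x := by
  obtain ⟨h1, S, hS, h2⟩ := hθ
  refine ⟨?_, S, hS, fun t ht x => by simp only [h2 t ht, zero_mul]⟩
  exact (h1.comp contDiff_fst).mul ((isSmooth_sinMode k).comp contDiff_snd)

namespace IsMLAlphaSolution

variable {ν α T : ℝ} {f uin : Fin 3 → Torus3 P → ℝ} {u ubar : Fin 3 → ℝ → Torus3 P → ℝ}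
  {p π : ℝ → Torus3 P → ℝ}

theorem memLp_slice {μ : Measure ℝ} [SFinite μ] {v : ℝ → Torus3 P → ℝ}
    (hv : MemLp (Function.uncurry v) 2 (μ.prod volume)) :
    ∀ᵐ t ∂μ, MemLp (v t) 2 volume := by
  filter_upwards [hv.integrable_sq.prod_right_ae, hv.1.prodMk_left] with t h1 h2
  exact (memLp_two_iff_integrable_sq h2).2 h1

theorem integrable_mul {μ : Measure ℝ} {v w : ℝ → Torus3 P → ℝ}
    (hv : MemLp (Function.uncurry v) 2 (μ.prod volume))
    (hw : MemLp (Function.uncurry w) 2 (μ.prod volume)) :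
    Integrable (Function.uncurry fun t x => v t x * w t x) (μ.prod volume) :=
  hv.integrable_mul hw

/-- The Fourier coefficient of `f_i - ∑_j ∂_j (u_j ubar_i) - ∂_i p`. -/
noncomputable def forcing (f : Fin 3 → Torus3 P → ℝ) (u ubar : Fin 3 → ℝ → Torus3 P → ℝ)
    (p : ℝ → Torus3 P → ℝ) (i : Fin 3) (k : Fin 3 → ℤ) (t : ℝ) : ℂ :=
  fourierCoeff (f i) k - Complex.I * (∑ j, (waveVec P k j : ℂ) *
    fourierCoeff (fun x => u j t x * ubar i t x) k + (waveVec P k i : ℂ) * fourierCoeff (p t) k)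

variable (h : IsMLAlphaSolution ν α T f uin u ubar p π)
include h

theorem integrable_fourierCoeff_u (i : Fin 3) (k : Fin 3 → ℤ) :
    IntegrableOn (fun t => fourierCoeff (u i t) k) (Ioo 0 T) :=
  integrable_fourierCoeff ((h.memLp_u i).integrable one_le_two) k

theorem integrable_forcing (i : Fin 3) (k : Fin 3 → ℤ) :
    IntegrableOn (forcing f u ubar p i k) (Ioo 0 T) := by
  refine (integrable_const _).sub (Integrable.const_mul (Integrable.add ?_ ?_) _)
  · exact integrable_finsetSum _ fun j _ => (integrable_fourierCoeff
      (integrable_mul (h.memLp_u j) (h.memLp_ubar i)) k).const_mul _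
  · exact (integrable_fourierCoeff h.integrable_p k).const_mul _

/-- Each Fourier coefficient of `u` is a weak solution of an ordinary differential equation. -/
theorem momentum_fourierCoeff (hf : ∀ i, Integrable (f i)) (huin : ∀ i, Integrable (uin i))
    (i : Fin 3) (k : Fin 3 → ℤ) {θ : ℝ → ℝ} (hθ : IsTimeTest T θ) :
    ∫ t in Ioo 0 T, (-(deriv θ t • fourierCoeff (u i t) k) +
      θ t • (((ν * waveSq P k : ℝ) : ℂ) * fourierCoeff (u i t) k - forcing f u ubar p i k t)) =
      θ 0 • fourierCoeff (uin i) k := by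
  set μ := volume.restrict (Ioo 0 T) with hμ
  have hP3 : P ^ 3 ≠ 0 := pow_ne_zero 3 hP.out.ne'
  have hθc : Continuous θ := hθ.1.continuous
  have hθd : Continuous (deriv θ) := hθ.1.continuous_deriv (by simp)
  let Z : ℝ → ℂ := fun t => -(deriv θ t • fourierCoeff (u i t) k) +
    θ t • (((ν * waveSq P k : ℝ) : ℂ) * fourierCoeff (u i t) k +
      Complex.I * (∑ j, (waveVec P k j : ℂ) * fourierCoeff (fun x => u j t x * ubar i t x) k +
        (waveVec P k i : ℂ) * fourierCoeff (p t) k))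
  let F : ℂ := fourierCoeff (f i) k
  have hF : Integrable (fun t => θ t • F) μ :=
    integrableOn_continuous_smul hθc (integrable_const F)
  have hY : Integrable (fun t => -(deriv θ t • fourierCoeff (u i t) k) +
      θ t • (((ν * waveSq P k : ℝ) : ℂ) * fourierCoeff (u i t) k - forcing f u ubar p i k t)) μ :=
    (integrableOn_continuous_smul hθd (h.integrable_fourierCoeff_u i k)).neg.add
      (integrableOn_continuous_smul hθc
        (((h.integrable_fourierCoeff_u i k).const_mul _).sub (h.integrable_forcing i k)))
  have hYZ : ∀ t, -(deriv θ t • fourierCoeff (u i t) k) +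
      θ t • (((ν * waveSq P k : ℝ) : ℂ) * fourierCoeff (u i t) k - forcing f u ubar p i k t) =
      Z t - θ t • F := fun t => by
    simp only [Z, F, forcing, Complex.real_smul]
    ring
  have hZ : Integrable Z μ := by
    refine (hY.add hF).congr (Filter.Eventually.of_forall fun t => ?_)
    simp only [Pi.add_apply, hYZ, sub_add_cancel]
  have hslice : ∀ᵐ t ∂μ, Integrable (u i t) ∧ Integrable (p t) ∧
      ∀ j, Integrable fun x => u j t x * ubar i t x := by
    have h3 : ∀ᵐ t ∂μ, ∀ j, Integrable fun x => u j t x * ubar i t x :=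
      ae_all_iff.2 fun j => (integrable_mul (h.memLp_u j) (h.memLp_ubar i)).prod_right_ae
    filter_upwards [((h.memLp_u i).integrable one_le_two).prod_right_ae,
      h.integrable_p.prod_right_ae, h3] with t a1 a2 a3
    exact ⟨a1, a2, a3⟩
  have hre : (∫ t, Z t ∂μ).re = (∫ t, θ t • F ∂μ).re + θ 0 * (fourierCoeff (uin i) k).re := by
    have hc := h.momentum i _ (isTestFunction_mul_cosMode hθ k)
    have e1 : ∫ t, (∫ x, (-(u i t x * deriv (fun s => θ s * cosMode P k x) t) -
        (∑ j, u j t x * ubar i t x * pderiv j (fun x => θ t * cosMode P k x) x) -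
        ν * (u i t x * laplacian (fun x => θ t * cosMode P k x) x) -
        p t x * pderiv i (fun x => θ t * cosMode P k x) x)) ∂μ = ∫ t, P ^ 3 * (Z t).re ∂μ := by
      refine integral_congr_ae ?_
      filter_upwards [hslice] with t ⟨a1, a2, a3⟩
      simp only [deriv_mul_const_field]
      exact integral_momentum_cosMode a1 a3 a2 ν (deriv θ t) (θ t) i k
    have e2 : ∀ t, ∫ x, f i x * (θ t * cosMode P k x) = P ^ 3 * (θ t • F).re := fun t => by
      simp only [mul_left_comm (f i _), integral_const_mul, integral_mul_cosMode (hf i),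
        Complex.smul_re, smul_eq_mul, F]
      ring
    have e3 : ∫ x, uin i x * (θ 0 * cosMode P k x) =
        P ^ 3 * (θ 0 * (fourierCoeff (uin i) k).re) := by
      simp only [mul_left_comm (uin i _), integral_const_mul, integral_mul_cosMode (huin i)]
      ring
    have hc' := e1.symm.trans hc
    simp only [e2, e3] at hc'
    rw [integral_const_mul, integral_const_mul, ← mul_add] at hc'
    have hc'' := mul_left_cancel₀ hP3 hc'
    simp only [← Complex.reCLM_apply] at hc'' ⊢
    rwa [← Complex.reCLM.integral_comp_comm hZ, ← Complex.reCLM.integral_comp_comm hF]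
  have him : (∫ t, Z t ∂μ).im = (∫ t, θ t • F ∂μ).im + θ 0 * (fourierCoeff (uin i) k).im := by
    have hc := h.momentum i _ (isTestFunction_mul_sinMode hθ k)
    have e1 : ∫ t, (∫ x, (-(u i t x * deriv (fun s => θ s * sinMode P k x) t) -
        (∑ j, u j t x * ubar i t x * pderiv j (fun x => θ t * sinMode P k x) x) -
        ν * (u i t x * laplacian (fun x => θ t * sinMode P k x) x) -
        p t x * pderiv i (fun x => θ t * sinMode P k x) x)) ∂μ =
        ∫ t, -(P ^ 3) * (Z t).im ∂μ := by
      refine integral_congr_ae ?_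
      filter_upwards [hslice] with t ⟨a1, a2, a3⟩
      simp only [deriv_mul_const_field, neg_mul]
      exact integral_momentum_sinMode a1 a3 a2 ν (deriv θ t) (θ t) i k
    have e2 : ∀ t, ∫ x, f i x * (θ t * sinMode P k x) = -(P ^ 3) * (θ t • F).im := fun t => by
      simp only [mul_left_comm (f i _), integral_const_mul, integral_mul_sinMode (hf i),
        Complex.smul_im, smul_eq_mul, F]
      ring
    have e3 : ∫ x, uin i x * (θ 0 * sinMode P k x) =
        -(P ^ 3) * (θ 0 * (fourierCoeff (uin i) k).im) := by
      simp only [mul_left_comm (uin i _), integral_const_mul, integral_mul_sinMode (huin i)]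
      ring
    have hc' := e1.symm.trans hc
    simp only [e2, e3] at hc'
    rw [integral_const_mul, integral_const_mul, ← mul_add] at hc'
    have hc'' := mul_left_cancel₀ (neg_ne_zero.2 hP3) hc'
    simp only [← Complex.imCLM_apply] at hc'' ⊢
    rwa [← Complex.imCLM.integral_comp_comm hZ, ← Complex.imCLM.integral_comp_comm hF]
  simp only [hYZ]
  rw [integral_sub hZ hF]
  apply Complex.ext
  · rw [Complex.sub_re, hre, Complex.smul_re, smul_eq_mul]
    ring
  · rw [Complex.sub_im, him, Complex.smul_im, smul_eq_mul]
    ring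

theorem sum_waveVec_mul_fourierCoeff_u :
    ∀ᵐ t ∂volume.restrict (Ioo 0 T), ∀ k,
      ∑ j, (waveVec P k j : ℂ) * fourierCoeff (u j t) k = 0 := by
  have h1 : ∀ᵐ t ∂volume.restrict (Ioo 0 T), ∀ i, Integrable (u i t) :=
    ae_all_iff.2 fun i => ((h.memLp_u i).integrable one_le_two).prod_right_ae
  filter_upwards [h1, h.div_u] with t a1 a2 k
  exact sum_waveVec_mul_fourierCoeff_eq_zero a1 a2 k

/-- The divergence of the momentum equation determines the pressure. -/
theorem sum_waveVec_mul_forcing (hT : 0 < T) (hf : ∀ i, Integrable (f i))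
    (huin : ∀ i, Integrable (uin i)) :
    ∀ᵐ t ∂volume.restrict (Ioo 0 T), ∀ k,
      ∑ i, (waveVec P k i : ℂ) * forcing f u ubar p i k t = 0 := by
  refine ae_all_iff.2 fun k => ?_
  refine ae_eq_zero_of_forall_integral
    (integrable_finsetSum _ fun i _ => (h.integrable_forcing i k).const_mul _) fun ζ h1 h2 h3 => ?_
  have hζ := isTimeTest_of_tsupport_subset hT h1 h2 h3
  have hζ0 : ζ 0 = 0 := image_eq_zero_of_notMem_tsupport fun hm => lt_irrefl _ (h3 hm).1
  have hζd : Continuous (deriv ζ) := h1.continuous_deriv (by simp)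
  have hY : ∀ i, IntegrableOn (fun t => -(deriv ζ t • fourierCoeff (u i t) k) +
      ζ t • (((ν * waveSq P k : ℝ) : ℂ) * fourierCoeff (u i t) k - forcing f u ubar p i k t))
      (Ioo 0 T) := fun i =>
    (integrableOn_continuous_smul hζd (h.integrable_fourierCoeff_u i k)).neg.add
      (integrableOn_continuous_smul h1.continuous
        (((h.integrable_fourierCoeff_u i k).const_mul _).sub (h.integrable_forcing i k)))
  have hsum : ∫ t in Ioo 0 T, ∑ i, (waveVec P k i : ℂ) *
      (-(deriv ζ t • fourierCoeff (u i t) k) +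
        ζ t • (((ν * waveSq P k : ℝ) : ℂ) * fourierCoeff (u i t) k - forcing f u ubar p i k t)) =
      0 := by
    rw [integral_finsetSum _ fun i _ => (hY i).const_mul _]
    simp only [integral_const_mul, h.momentum_fourierCoeff hf huin _ k hζ, hζ0, zero_smul, mul_zero,
      Finset.sum_const_zero]
  rw [← neg_eq_zero, ← hsum, ← integral_neg]
  refine integral_congr_ae ?_
  filter_upwards [h.sum_waveVec_mul_fourierCoeff_u] with t ht
  have ht := ht k
  simp only [Fin.sum_univ_three, Complex.real_smul] at ht ⊢
  linear_combination (((deriv ζ t : ℝ) : ℂ) - ζ t * ((ν * waveSq P k : ℝ) : ℂ)) * ht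

end IsMLAlphaSolution

end Torus3

namespace Torus3

open Set MLAlpha
open scoped ENNReal NNReal

/-! ### Sobolev norms in space and time -/

variable {P : ℝ} [hP : Fact (0 < P)]

theorem sobolevNorm_sq (s : ℕ) (g : Torus3 P → ℝ) :
    sobolevNorm s g ^ 2 = ∑' k, sobolevWeight P k ^ s * ‖fourierCoeff g k‖ₑ ^ 2 := by
  rw [sobolevNorm, ← ENNReal.rpow_natCast, ← ENNReal.rpow_mul]
  norm_num
  refine tsum_congr fun k => ?_
  rw [sobolevWeight, ENNReal.ofReal_pow]
  linarith [waveSq_nonneg (P := P) k]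

theorem sobolevNorm_lt_top_iff {s : ℕ} {g : Torus3 P → ℝ} :
    sobolevNorm s g < ⊤ ↔ ∑' k, sobolevWeight P k ^ s * ‖fourierCoeff g k‖ₑ ^ 2 ≠ ⊤ := by
  rw [← sobolevNorm_sq, lt_top_iff_ne_top, not_iff_not]
  simp

variable {T : ℝ} {s : ℕ} {v : ℝ → Torus3 P → ℝ}

theorem memLpSobolev_top
    (hv : AEStronglyMeasurable (Function.uncurry v) ((volume.restrict (Ioo 0 T)).prod volume))
    (hv2 : ∀ᵐ t ∂volume.restrict (Ioo 0 T), MemLp (v t) 2 volume) {M : ℝ≥0∞} (hM : M ≠ ⊤)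
    (h : ∀ᵐ t ∂volume.restrict (Ioo 0 T),
      ∑' k, sobolevWeight P k ^ s * ‖fourierCoeff (v t) k‖ₑ ^ 2 ≤ M) :
    MemLpSobolev ⊤ s T v := by
  refine ⟨hv, ?_, ?_⟩
  · filter_upwards [hv2, h] with t h1 h2
    exact ⟨h1, sobolevNorm_lt_top_iff.2 (ne_top_of_le_ne_top hM h2)⟩
  · rw [eLpNorm_exponent_top]
    refine lt_of_le_of_lt (b := 1 + M) (essSup_le_of_ae_le _ ?_)
      (ENNReal.add_lt_top.2 ⟨ENNReal.one_lt_top, hM.lt_top⟩)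
    filter_upwards [h] with t ht
    rw [← sobolevNorm_sq] at ht
    rw [enorm_eq_self]
    rcases le_total (sobolevNorm s (v t)) 1 with h1 | h1
    · exact h1.trans le_self_add
    · exact ((le_self_pow₀ h1 two_ne_zero).trans ht).trans le_add_self

theorem memLpSobolev_two
    (hv : AEStronglyMeasurable (Function.uncurry v) ((volume.restrict (Ioo 0 T)).prod volume))
    (hv2 : ∀ᵐ t ∂volume.restrict (Ioo 0 T), MemLp (v t) 2 volume) {X : ℝ → ℝ≥0∞}
    (hXm : AEMeasurable X (volume.restrict (Ioo 0 T))) (hX : ∫⁻ t in Ioo 0 T, X t ≠ ⊤)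
    (h : ∀ᵐ t ∂volume.restrict (Ioo 0 T),
      ∑' k, sobolevWeight P k ^ s * ‖fourierCoeff (v t) k‖ₑ ^ 2 ≤ X t) :
    MemLpSobolev 2 s T v := by
  refine ⟨hv, ?_, ?_⟩
  · filter_upwards [hv2, h, ae_lt_top' hXm hX] with t h1 h2 h3
    exact ⟨h1, sobolevNorm_lt_top_iff.2 (h2.trans_lt h3).ne⟩
  · rw [eLpNorm_lt_top_iff_lintegral_rpow_enorm_lt_top (by simp) (by simp)]
    refine lt_of_le_of_lt (lintegral_mono_ae ?_) hX.lt_top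
    filter_upwards [h] with t ht
    rw [← sobolevNorm_sq] at ht
    simpa using ht

/-! ### Bounds for the forcing and the pressure -/

omit hP in
theorem waveSq_ge {k : Fin 3 → ℤ} (hk : k ≠ 0) : (2 * Real.pi / P) ^ 2 ≤ waveSq P k := by
  obtain ⟨j, hj⟩ := Function.ne_iff.1 hk
  have h1 : (1 : ℝ) ≤ (k j : ℝ) ^ 2 := by
    have : (1 : ℤ) ≤ k j ^ 2 := by
      have hj' : k j ≠ 0 := hj
      have h0 : 0 < k j ^ 2 := by positivity
      exact Int.add_one_le_iff.2 h0
    exact_mod_cast this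
  have h2 : waveVec P k j ^ 2 ≤ waveSq P k := Finset.single_le_sum
    (f := fun j => waveVec P k j ^ 2) (fun _ _ => sq_nonneg _) (Finset.mem_univ j)
  have h3 : waveVec P k j ^ 2 = (2 * Real.pi / P) ^ 2 * (k j : ℝ) ^ 2 := by
    rw [waveVec]
    ring
  rw [h3] at h2
  exact (le_mul_of_one_le_right (sq_nonneg _) h1).trans h2

theorem waveSq_pos {k : Fin 3 → ℤ} (hk : k ≠ 0) : 0 < waveSq P k := by
  refine lt_of_lt_of_le ?_ (waveSq_ge hk)
  have := hP.out
  positivity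

/-- If the projection of `F - i(Nκ + κp)` on the wave vector `κ` vanishes, then `p` and this vector
are controlled by `F` and `N`. -/
theorem norm_le_of_projection_eq_zero {κ : Fin 3 → ℝ} {F : Fin 3 → ℂ} {N : Fin 3 → Fin 3 → ℂ}
    {p : ℂ}
    {s : ℝ} (hs : 0 < s) (hs2 : s ^ 2 = ∑ i, κ i ^ 2)
    (h : ∑ i, (κ i : ℂ) * (F i - Complex.I * (∑ j, (κ j : ℂ) * N i j + (κ i : ℂ) * p)) = 0) :
    ‖p‖ ≤ s⁻¹ * ∑ i, ‖F i‖ + ∑ i, ∑ j, ‖N i j‖ ∧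
    ∀ i, ‖F i - Complex.I * (∑ j, (κ j : ℂ) * N i j + (κ i : ℂ) * p)‖ ≤
      2 * (s * (s⁻¹ * ∑ i, ‖F i‖ + ∑ i, ∑ j, ‖N i j‖)) := by
  have hκ : ∀ i, |κ i| ≤ s := fun i => by
    rw [← abs_of_pos hs, ← sq_le_sq, hs2]
    exact Finset.single_le_sum (f := fun i => κ i ^ 2) (fun _ _ => sq_nonneg _) (Finset.mem_univ i)
  have hdot : ∀ (a : ℝ) (z : ℂ), |a| ≤ s → ‖(a : ℂ) * z‖ ≤ s * ‖z‖ := fun a z ha => by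
    rw [norm_mul, Complex.norm_real, Real.norm_eq_abs]
    gcongr
  have hNi : ∀ i, ‖∑ j, (κ j : ℂ) * N i j‖ ≤ s * ∑ j, ‖N i j‖ := fun i => by
    rw [Finset.mul_sum]
    exact norm_sum_le_of_le _ fun j _ => hdot _ _ (hκ j)
  have e : Complex.I * (((s ^ 2 : ℝ) : ℂ) * p) =
      ∑ i, (κ i : ℂ) * (F i - Complex.I * ∑ j, (κ j : ℂ) * N i j) := by
    rw [hs2]
    push_cast
    simp only [Fin.sum_univ_three] at h ⊢
    linear_combination -h
  have hp : s ^ 2 * ‖p‖ ≤ s ^ 2 * (s⁻¹ * ∑ i, ‖F i‖ + ∑ i, ∑ j, ‖N i j‖) := by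
    have e1 : ‖Complex.I * (((s ^ 2 : ℝ) : ℂ) * p)‖ = s ^ 2 * ‖p‖ := by
      rw [norm_mul, norm_mul, Complex.norm_I, one_mul, Complex.norm_real,
        Real.norm_of_nonneg (sq_nonneg s)]
    rw [← e1, e]
    calc ‖∑ i, (κ i : ℂ) * (F i - Complex.I * ∑ j, (κ j : ℂ) * N i j)‖
        ≤ ∑ i, s * (‖F i‖ + s * ∑ j, ‖N i j‖) := by
          refine norm_sum_le_of_le _ fun i _ => (hdot _ _ (hκ i)).trans ?_
          gcongr
          refine (norm_sub_le _ _).trans ?_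
          rw [norm_mul, Complex.norm_I, one_mul]
          gcongr
          exact hNi i
      _ = _ := by
          rw [← Finset.mul_sum, Finset.sum_add_distrib, ← Finset.mul_sum]
          field_simp
  have hp' := le_of_mul_le_mul_left hp (by positivity)
  refine ⟨hp', fun i => ?_⟩
  have hF : ‖F i‖ ≤ ∑ i, ‖F i‖ :=
    Finset.single_le_sum (f := fun i => ‖F i‖) (fun _ _ => norm_nonneg _) (Finset.mem_univ i)
  have hN : ∑ j, ‖N i j‖ ≤ ∑ i, ∑ j, ‖N i j‖ :=
    Finset.single_le_sum (f := fun i => ∑ j, ‖N i j‖)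
      (fun _ _ => Finset.sum_nonneg fun _ _ => norm_nonneg _) (Finset.mem_univ i)
  calc ‖F i - Complex.I * (∑ j, (κ j : ℂ) * N i j + (κ i : ℂ) * p)‖
      ≤ ‖F i‖ + (s * ∑ j, ‖N i j‖ + s * ‖p‖) := by
        refine (norm_sub_le _ _).trans ?_
        rw [norm_mul, Complex.norm_I, one_mul]
        gcongr
        exact (norm_add_le _ _).trans (add_le_add (hNi i) (hdot _ _ (hκ i)))
    _ ≤ (∑ i, ‖F i‖) + (s * ∑ i, ∑ j, ‖N i j‖ +
          s * (s⁻¹ * ∑ i, ‖F i‖ + ∑ i, ∑ j, ‖N i j‖)) := by gcongr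
    _ = _ := by
        field_simp
        ring

/-- The length of the wave vector, in `[0, ∞]`. -/
noncomputable def waveLength (P : ℝ) (k : Fin 3 → ℤ) : ℝ≥0∞ := ENNReal.ofReal √(waveSq P k)

omit hP in
theorem waveLength_sq (k : Fin 3 → ℤ) : waveLength P k ^ 2 = ENNReal.ofReal (waveSq P k) := by
  rw [waveLength, ← ENNReal.ofReal_pow (Real.sqrt_nonneg _), Real.sq_sqrt (waveSq_nonneg k)]

omit hP in
theorem sobolevWeight_eq (k : Fin 3 → ℤ) : sobolevWeight P k = 1 + waveLength P k ^ 2 := by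
  rw [waveLength_sq, sobolevWeight, ENNReal.ofReal_add zero_le_one (waveSq_nonneg k),
    ENNReal.ofReal_one]

/-- The sum of the moduli of the Fourier coefficients of the components of a vector field. -/
noncomputable def coeffSum (g : Fin 3 → Torus3 P → ℝ) (k : Fin 3 → ℤ) : ℝ≥0∞ :=
  ∑ i, ‖fourierCoeff (g i) k‖ₑ

/-- The moduli of the Fourier coefficients of the force, divided by the length of the wave vector;
the value at `k = 0` is irrelevant, as all fields have mean zero, and is set to `0`. -/
noncomputable def reducedForce (f : Fin 3 → Torus3 P → ℝ) (k : Fin 3 → ℤ) : ℝ≥0∞ :=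
  if k = 0 then 0 else (waveLength P k)⁻¹ * coeffSum f k

theorem coeffSum_sq_le (g : Fin 3 → Torus3 P → ℝ) (k : Fin 3 → ℤ) :
    coeffSum g k ^ 2 ≤ 3 * ∑ i, ‖fourierCoeff (g i) k‖ₑ ^ 2 := by
  have := sq_tsum_mul_le (fun _ : Fin 3 => (1 : ℝ≥0∞)) fun i => ‖fourierCoeff (g i) k‖ₑ
  simpa [coeffSum, tsum_fintype] using this

theorem tsum_mul_coeffSum_sq_le (g : Fin 3 → Torus3 P → ℝ) (W : (Fin 3 → ℤ) → ℝ≥0∞) :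
    ∑' k, W k * coeffSum g k ^ 2 ≤ 3 * ∑ i, ∑' k, W k * ‖fourierCoeff (g i) k‖ₑ ^ 2 := by
  rw [← Summable.tsum_finsetSum fun i _ => ENNReal.summable, ← ENNReal.tsum_mul_left]
  refine ENNReal.tsum_le_tsum fun k => ?_
  rw [← Finset.mul_sum, mul_left_comm]
  gcongr
  exact coeffSum_sq_le g k

theorem tsum_mul_coeffSum_sq_ne_top {g : Fin 3 → Torus3 P → ℝ} {s : ℕ}
    (hg : ∀ i, MemSobolev s (g i)) : ∑' k, sobolevWeight P k ^ s * coeffSum g k ^ 2 ≠ ⊤ :=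
  ne_top_of_le_ne_top (ENNReal.mul_ne_top (by simp) (ENNReal.sum_ne_top.2 fun i _ =>
    sobolevNorm_lt_top_iff.1 (hg i).2)) (tsum_mul_coeffSum_sq_le g _)

/-- For `f ∈ H^{m-1}` the reduced force is in `H^m`. -/
theorem tsum_mul_reducedForce_sq_ne_top {f : Fin 3 → Torus3 P → ℝ} {m : ℕ} (hm : 1 ≤ m)
    (hf : ∀ i, MemSobolev (m - 1) (f i)) :
    ∑' k, sobolevWeight P k ^ m * reducedForce f k ^ 2 ≠ ⊤ := by
  have hP0 := hP.out
  set a : ℝ := (2 * Real.pi / P) ^ 2 with ha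
  have ha0 : 0 < a := by positivity
  refine ne_top_of_le_ne_top (ENNReal.mul_ne_top (ENNReal.ofReal_ne_top (r := 1 + a⁻¹))
    (tsum_mul_coeffSum_sq_ne_top hf)) ?_
  rw [← ENNReal.tsum_mul_left]
  refine ENNReal.tsum_le_tsum fun k => ?_
  by_cases hk : k = 0
  · simp [reducedForce, hk]
  have hw := waveSq_pos (P := P) hk
  have hJ : sobolevWeight P k * (waveLength P k)⁻¹ ^ 2 ≤ ENNReal.ofReal (1 + a⁻¹) := by
    rw [← ENNReal.inv_pow, waveLength_sq, sobolevWeight, ← ENNReal.ofReal_inv_of_pos hw,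
      ← ENNReal.ofReal_mul (by linarith)]
    refine ENNReal.ofReal_le_ofReal ?_
    rw [add_mul, one_mul, mul_inv_cancel₀ hw.ne', add_comm]
    gcongr
    exact waveSq_ge hk
  obtain ⟨n, rfl⟩ : ∃ n, m = n + 1 := ⟨m - 1, by omega⟩
  rw [reducedForce, if_neg hk, mul_pow, pow_succ]
  calc sobolevWeight P k ^ n * sobolevWeight P k * ((waveLength P k)⁻¹ ^ 2 * coeffSum f k ^ 2)
      = (sobolevWeight P k * (waveLength P k)⁻¹ ^ 2) *
          (sobolevWeight P k ^ n * coeffSum f k ^ 2) := by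
        ring
    _ ≤ ENNReal.ofReal (1 + a⁻¹) * (sobolevWeight P k ^ n * coeffSum f k ^ 2) := by gcongr
    _ = _ := by rw [Nat.add_sub_cancel]

namespace IsMLAlphaSolution

variable {ν α : ℝ} {f uin : Fin 3 → Torus3 P → ℝ} {u ubar : Fin 3 → ℝ → Torus3 P → ℝ}
  {p π : ℝ → Torus3 P → ℝ}

/-- The modulus of the Fourier coefficients of the solution at time `t`. -/
noncomputable def modulus (u : Fin 3 → ℝ → Torus3 P → ℝ) (k : Fin 3 → ℤ) (t : ℝ) : ℝ≥0∞ :=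
  coeffSum (fun i => u i t) k

variable (h : IsMLAlphaSolution ν α T f uin u ubar p π)
include h

theorem aemeasurable_modulus (k : Fin 3 → ℤ) :
    AEMeasurable (modulus u k) (volume.restrict (Ioo 0 T)) :=
  Finset.aemeasurable_fun_sum (f := fun i t => ‖fourierCoeff (u i t) k‖ₑ) Finset.univ
    fun i _ => (h.integrable_fourierCoeff_u i k).1.enorm

theorem lintegral_tsum_modulus_sq_ne_top : ∫⁻ t in Ioo 0 T, ∑' k, modulus u k t ^ 2 ≠ ⊤ := by
  have hP3 : (0 : ℝ) < P ^ 3 := pow_pos hP.out 3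
  have hP3' : ENNReal.ofReal (P ^ 3) ≠ 0 := by simpa using hP3
  have hsl : ∀ᵐ t ∂volume.restrict (Ioo 0 T), ∀ i, MemLp (u i t) 2 volume :=
    ae_all_iff.2 fun i => memLp_slice (h.memLp_u i)
  have hm : ∀ i, AEMeasurable (fun z : ℝ × Torus3 P => ‖u i z.1 z.2‖ₑ ^ 2)
      ((volume.restrict (Ioo 0 T)).prod volume) := fun i => (h.memLp_u i).1.enorm.pow_const 2
  have hfin : ∀ i, ∫⁻ t in Ioo 0 T, ∫⁻ x, ‖u i t x‖ₑ ^ 2 ≠ ⊤ := fun i => by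
    rw [← lintegral_prod _ (hm i)]
    have := (eLpNorm_lt_top_iff_lintegral_rpow_enorm_lt_top (by simp) (by simp)).1 (h.memLp_u i).2
    simpa [Function.uncurry_def] using this.ne
  refine ne_top_of_le_ne_top (b := ∫⁻ t in Ioo 0 T, 3 * ∑ i, (ENNReal.ofReal (P ^ 3))⁻¹ *
    ∫⁻ x, ‖u i t x‖ₑ ^ 2) ?_ (lintegral_mono_ae ?_)
  · rw [lintegral_const_mul' _ _ (by simp), lintegral_finsetSum' _ fun i _ =>
      ((hm i).lintegral_prod_right').const_mul _]
    refine ENNReal.mul_ne_top (by simp) (ENNReal.sum_ne_top.2 fun i _ => ?_)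
    rw [lintegral_const_mul' _ _ (by simpa using hP3)]
    exact ENNReal.mul_ne_top (by simpa using hP3) (hfin i)
  · filter_upwards [hsl] with t ht
    have h1 := tsum_mul_coeffSum_sq_le (fun i => u i t) (fun _ => 1)
    simp only [one_mul] at h1
    refine h1.trans ?_
    gcongr with i
    rw [← one_mul (∑' k, _), ← ENNReal.inv_mul_cancel hP3' ENNReal.ofReal_ne_top, mul_assoc]
    gcongr
    exact tsum_enorm_fourierCoeff_sq_le (ht i)

/-- The quadratic term is dominated by the convolution of the moduli. -/
theorem sum_enorm_fourierCoeff_mul_le (hα : 0 < α) :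
    ∀ᵐ t ∂volume.restrict (Ioo 0 T), ∀ k,
      ∑ i, ∑ j, ‖fourierCoeff (fun x => u j t x * ubar i t x) k‖ₑ ≤
        ENNReal.ofReal (1 + (α ^ 2)⁻¹) *
          smoothedConv (sobolevWeight P) (fun l => modulus u l t) k := by
  have hu : ∀ᵐ t ∂volume.restrict (Ioo 0 T), ∀ i, MemLp (u i t) 2 volume :=
    ae_all_iff.2 fun i => memLp_slice (h.memLp_u i)
  have hb : ∀ᵐ t ∂volume.restrict (Ioo 0 T), ∀ i, MemLp (ubar i t) 2 volume :=
    ae_all_iff.2 fun i => memLp_slice (h.memLp_ubar i)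
  filter_upwards [hu, hb, h.integrable_π, h.filter, h.div_u, h.div_ubar] with t a1 a2 a3 a4 a5 a6 k
  have hbar : ∀ i l, ‖fourierCoeff (ubar i t) l‖ₑ ≤ ENNReal.ofReal (1 + (α ^ 2)⁻¹) *
      (‖fourierCoeff (u i t) l‖ₑ * (sobolevWeight P l)⁻¹) := fun i l =>
    enorm_le_of_mul_eq hα l (fourierCoeff_filtered (fun i => (a2 i).integrable one_le_two)
      (fun i => (a1 i).integrable one_le_two) a3 a4 a5 a6 i l)
  calc ∑ i, ∑ j, ‖fourierCoeff (fun x => u j t x * ubar i t x) k‖ₑ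
      ≤ ∑ i, ∑ j, ∑' l, ‖fourierCoeff (u j t) l‖ₑ * (ENNReal.ofReal (1 + (α ^ 2)⁻¹) *
          (‖fourierCoeff (u i t) (k - l)‖ₑ * (sobolevWeight P (k - l))⁻¹)) := by
        gcongr with i _ j _
        refine (enorm_fourierCoeff_mul_le (a2 i) (a1 j) k).trans ?_
        gcongr with l
        exact hbar i _
    _ = _ := by
        simp only [← Summable.tsum_finsetSum fun i _ => ENNReal.summable]
        rw [smoothedConv, ← ENNReal.tsum_mul_left]
        refine tsum_congr fun l => ?_
        simp only [modulus, coeffSum, Fin.sum_univ_three]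
        ring

/-- The pressure and the forcing are controlled by the reduced force and the quadratic term. -/
theorem enorm_pressure_forcing_le (hT : 0 < T) (hα : 0 < α) (hf : ∀ i, Integrable (f i))
    (huin : ∀ i, Integrable (uin i)) :
    ∀ᵐ t ∂volume.restrict (Ioo 0 T), ∀ k ≠ 0,
      ‖fourierCoeff (p t) k‖ₑ ≤ ENNReal.ofReal (1 + (α ^ 2)⁻¹) *
        (smoothedConv (sobolevWeight P) (fun l => modulus u l t) k + reducedForce f k) ∧
      ∀ i, ‖forcing f u ubar p i k t‖ₑ ≤ waveLength P k * (2 * (ENNReal.ofReal (1 + (α ^ 2)⁻¹) *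
        (smoothedConv (sobolevWeight P) (fun l => modulus u l t) k + reducedForce f k))) := by
  filter_upwards [h.sum_waveVec_mul_forcing hT hf huin, h.sum_enorm_fourierCoeff_mul_le hα]
    with t h1 h2 k hk
  have hs : 0 < √(waveSq P k) := Real.sqrt_pos.2 (waveSq_pos hk)
  obtain ⟨hp, hg⟩ := norm_le_of_projection_eq_zero hs
    (by rw [Real.sq_sqrt (waveSq_nonneg k), waveSq_eq_sum]) (h1 k)
  have hC : 1 ≤ ENNReal.ofReal (1 + (α ^ 2)⁻¹) := by
    rw [ENNReal.one_le_ofReal]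
    exact le_add_of_nonneg_right (by positivity)
  have hQ : ENNReal.ofReal ((√(waveSq P k))⁻¹ * ∑ i, ‖fourierCoeff (f i) k‖ +
      ∑ i, ∑ j, ‖fourierCoeff (fun x => u j t x * ubar i t x) k‖) ≤
      ENNReal.ofReal (1 + (α ^ 2)⁻¹) *
        (smoothedConv (sobolevWeight P) (fun l => modulus u l t) k + reducedForce f k) := by
    rw [ENNReal.ofReal_add (by positivity) (by positivity), ENNReal.ofReal_mul (by positivity),
      ENNReal.ofReal_inv_of_pos hs, ENNReal.ofReal_sum_of_nonneg fun _ _ => by positivity,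
      ENNReal.ofReal_sum_of_nonneg fun _ _ => by positivity, add_comm, mul_add]
    refine add_le_add ?_ ?_
    · refine le_trans (le_of_eq ?_) (h2 k)
      refine Finset.sum_congr rfl fun i _ => ?_
      rw [ENNReal.ofReal_sum_of_nonneg fun _ _ => by positivity]
      simp only [ofReal_norm]
    · rw [reducedForce, if_neg hk]
      refine le_mul_of_one_le_of_le hC (le_of_eq ?_)
      simp only [waveLength, coeffSum, ofReal_norm]
  refine ⟨?_, fun i => ?_⟩
  · rw [← ofReal_norm]
    exact (ENNReal.ofReal_le_ofReal hp).trans hQ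
  · rw [← ofReal_norm]
    refine (ENNReal.ofReal_le_ofReal (hg i)).trans ?_
    rw [ENNReal.ofReal_mul (by norm_num), ENNReal.ofReal_mul hs.le, ENNReal.ofReal_ofNat,
      mul_left_comm, ← waveLength]
    gcongr

omit h in
theorem fourierCoeff_zero_of_integral_eq_zero {g : Torus3 P → ℝ} (hg : ∫ x, g x = 0) :
    fourierCoeff g 0 = 0 := by
  have : ∀ x : Torus3 P, mode P (-0) x * (g x : ℂ) = (g x : ℂ) := fun x => by
    simp [mode_apply]
  rw [fourierCoeff_eq]
  simp only [this]
  rw [integral_complex_ofReal, hg]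
  simp

/-- The Fourier coefficients of a solution satisfy the hypotheses of the abstract bootstrap. -/
theorem isSolutionMajorant (hν : 0 < ν) (hα : 0 < α) (hT : 0 < T) (hf : ∀ i, Integrable (f i))
    (huin : ∀ i, Integrable (uin i)) :
    IsSolutionMajorant T (sobolevWeight P) (waveLength P) (coeffSum uin) (reducedForce f)
      (fun k => ν * waveSq P k) (ENNReal.ofReal ν⁻¹) (3 * (2 * ENNReal.ofReal (1 + (α ^ 2)⁻¹)))
      (modulus u) where
  weight := isFrequencyWeight_sobolevWeight
  weight_eq := sobolevWeight_eq
  rate_nonneg k := mul_nonneg hν.le (waveSq_nonneg k)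
  smoothing k := by
    rw [waveLength_sq]
    rcases (waveSq_nonneg (P := P) k).eq_or_lt with h0 | h0
    · simp [← h0]
    · rw [lintegral_decay (by positivity), ← ENNReal.ofReal_mul h0.le]
      refine ENNReal.ofReal_le_ofReal (le_of_eq ?_)
      field_simp
  smoothing_ne_top := ENNReal.ofReal_ne_top
  const_ne_top := by finiteness
  aemeasurable := h.aemeasurable_modulus
  lintegral_ne_top := h.lintegral_tsum_modulus_sq_ne_top
  majorized := by
    have hduh : ∀ᵐ t ∂volume.restrict (Ioo 0 T), ∀ k i, fourierCoeff (u i t) k =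
        Real.exp (-(ν * waveSq P k) * t) • fourierCoeff (uin i) k +
        ∫ s in Ioo 0 T, (Iio t).indicator (fun s => Real.exp (-(ν * waveSq P k) * (t - s)) •
          forcing f u ubar p i k s) s :=
      ae_all_iff.2 fun k => ae_all_iff.2 fun i =>
        ae_eq_duhamel hT (h.integrable_fourierCoeff_u i k) (h.integrable_forcing i k)
          fun θ hθ => h.momentum_fourierCoeff hf huin i k hθ
    filter_upwards [hduh, h.mean_u, ae_restrict_mem measurableSet_Ioo] with t ht hmean htT k
    by_cases hk : k = 0
    · have : modulus u k t = 0 := by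
        simp [modulus, coeffSum, hk, fourierCoeff_zero_of_integral_eq_zero (hmean _)]
      rw [this]
      exact zero_le
    set Q : ℝ → ℝ≥0∞ := fun s => ENNReal.ofReal (1 + (α ^ 2)⁻¹) *
      (smoothedConv (sobolevWeight P) (fun l => modulus u l s) k + reducedForce f k) with hQ
    calc modulus u k t
        ≤ ∑ i, (decay (ν * waveSq P k) t * ‖fourierCoeff (uin i) k‖ₑ +
            ∫⁻ s in Ioo 0 T, decay (ν * waveSq P k) (t - s) * ‖forcing f u ubar p i k s‖ₑ) := by
          rw [modulus, coeffSum]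
          refine Finset.sum_le_sum fun i _ => ?_
          rw [ht k i]
          exact enorm_duhamel_le htT.1
      _ ≤ ∑ i : Fin 3, (decay (ν * waveSq P k) t * ‖fourierCoeff (uin i) k‖ₑ +
            ∫⁻ s in Ioo 0 T, decay (ν * waveSq P k) (t - s) * (waveLength P k * (2 * Q s))) := by
          refine Finset.sum_le_sum fun i _ => ?_
          refine add_le_add_right (lintegral_mono_ae ?_) _
          filter_upwards [h.enorm_pressure_forcing_le hT hα hf huin] with s hs
          gcongr
          exact (hs k hk).2 i
      _ = _ := by
          rw [Finset.sum_add_distrib, ← Finset.mul_sum, Finset.sum_const, Finset.card_univ,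
            Fintype.card_fin, nsmul_eq_mul, ← lintegral_const_mul' _ _ (by simp),
            ← lintegral_const_mul' (waveLength P k) _ ENNReal.ofReal_ne_top]
          refine congrArg₂ _ rfl (lintegral_congr fun s => ?_)
          simp only [hQ]
          push_cast
          ring

end IsMLAlphaSolution

end Torus3

theorem proposition1 (P ν α T : ℝ) [Fact (0 < P)] (hν : 0 < ν) (hα : 0 < α) (hT : 0 < T)
    (m : ℕ) (hm : 1 ≤ m)
    (f uin : Fin 3 → Torus3 P → ℝ)
    (hf : ∀ i, Torus3.MemSobolev (m - 1) (f i))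
    (huin : ∀ i, Torus3.MemSobolev m (uin i))
    (u ubar : Fin 3 → ℝ → Torus3 P → ℝ) (p π : ℝ → Torus3 P → ℝ)
    (h : Torus3.IsMLAlphaSolution ν α T f uin u ubar p π) :
    (∀ i, Torus3.MemLpSobolev ⊤ m T (u i)) ∧
    (∀ i, Torus3.MemLpSobolev 2 (m + 1) T (u i)) ∧
    Torus3.MemLpSobolev 2 m T p := by
  have hfi := fun i => (hf i).1.integrable one_le_two
  have hui := fun i => (huin i).1.integrable one_le_two
  have hmaj := h.isSolutionMajorant hν hα hT hfi hui
  have hH := Torus3.tsum_mul_reducedForce_sq_ne_top hm hf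
  obtain ⟨⟨M, hM, hbound⟩, hgain, hconv⟩ :=
    hmaj.regularity (Torus3.tsum_mul_coeffSum_sq_ne_top huin) hH
  have hle : ∀ (s : ℕ) (i : Fin 3) (t : ℝ),
      ∑' k, Torus3.sobolevWeight P k ^ s * ‖Torus3.fourierCoeff (u i t) k‖ₑ ^ 2 ≤
        ∑' k, Torus3.sobolevWeight P k ^ s *
          Torus3.IsMLAlphaSolution.modulus u k t ^ 2 := fun s i t => by
    refine ENNReal.tsum_le_tsum fun k => ?_
    gcongr
    exact Finset.single_le_sum (f := fun i => ‖Torus3.fourierCoeff (u i t) k‖ₑ)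
      (fun _ _ => zero_le) (Finset.mem_univ i)
  refine ⟨fun i => ?_, fun i => ?_, ?_⟩
  · refine Torus3.memLpSobolev_top (h.memLp_u i).1
      (Torus3.IsMLAlphaSolution.memLp_slice (h.memLp_u i)) hM ?_
    filter_upwards [hbound] with t ht
    exact (hle m i t).trans ht
  · exact Torus3.memLpSobolev_two (h.memLp_u i).1
      (Torus3.IsMLAlphaSolution.memLp_slice (h.memLp_u i))
      (MLAlpha.aemeasurable_tsum_mul_sq hmaj.aemeasurable _) hgain
      (Filter.Eventually.of_forall fun t => hle (m + 1) i t)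
  · set C := ENNReal.ofReal (1 + (α ^ 2)⁻¹)
    have hGm := MLAlpha.aemeasurable_tsum_mul_sq hmaj.aemeasurable_smoothedConv
      (fun k => Torus3.sobolevWeight P k ^ m)
    refine Torus3.memLpSobolev_two h.integrable_p.1 h.memLp_p
      (X := fun t => 4 * C ^ 2 * (∑' k, Torus3.sobolevWeight P k ^ m * MLAlpha.smoothedConv
        (Torus3.sobolevWeight P) (fun l => Torus3.IsMLAlphaSolution.modulus u l t) k ^ 2 +
        ∑' k, Torus3.sobolevWeight P k ^ m * Torus3.reducedForce f k ^ 2))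
      ((hGm.add_const _).const_mul _) ?_ ?_
    · rw [lintegral_const_mul'' _ (hGm.add_const _), lintegral_add_right _ measurable_const,
        lintegral_const]
      have hvol : volume.restrict (Set.Ioo 0 T) Set.univ ≠ ⊤ := by simp
      finiteness
    · filter_upwards [h.enorm_pressure_forcing_le hT hα hfi hui, h.mean_p] with t ht hmean
      refine le_trans (ENNReal.tsum_le_tsum fun k => ?_)
        (MLAlpha.IsSolutionMajorant.tsum_mul_forcing_sq_le C _ _ _)
      gcongr
      by_cases hk : k = 0
      · rw [hk, Torus3.IsMLAlphaSolution.fourierCoeff_zero_of_integral_eq_zero hmean, enorm_zero]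
        exact zero_le
      · exact (ht k hk).1
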